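/- A profile $\eta:\mathbb R\to\mathbb R$ is called single-lobe if it is $2\pi$-periodic, even, and its local maximum points are exactly the points of $2\pi\mathbb Z$ (a single maximum on $\mathbb T=\mathbb R/2\pi\mathbb Z$, placed at $u=0$). Consider for $c>0$ the equation $$(c^2-2\eta)\eta''-(\eta')^2+\eta=0. \qquad (\ast)$$ A $C^\infty$ profile solves $(\ast)$ if it does so at every point. A continuous periodic profile with weak derivative $\eta'\in L^2(\mathbb T)$ solves $(\ast)$ if $((c^2-2\eta)\eta')'+(\eta')^2+\eta=0$ holds weakly on $\mathbb T$, i.e. $\int_{-\pi}^{\pi}\big[(c^2-2\eta)\eta'\varphi'-(\eta')^2\varphi-\eta\varphi\big]\,du=0$ for every $2\pi$-periodic $\varphi\in C^\infty$. Let $c_*=\frac{\pi}{2\sqrt2}$. (1) For every $c\in(1,c_*)$ there is a unique single-lobe solution $\eta=\eta_c\in C^\infty_{\rm per}(\mathbb T)$ of $(\ast)$, and $\|\eta_c\|_{L^\infty}\to0$ as $c\to1^+$. (2) There is $c_\infty\in(c_*,\infty)$ such that for every $c\in(c_*,c_\infty)$ equation $(\ast)$ has a single-lobe solution $\eta\in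 C^0_{\rm per}(\mathbb T)$ which is smooth and satisfies $(\ast)$ pointwise on $\mathbb R\setminus2\pi\mathbb Z$, and for which, for some constant $A(c)>0$, $$\eta(u)=\frac{c^2}{2}-A(c)|u|^{2/3}+\mathcal O(|u|^{4/3})\quad\text{as }u\to0.$$ (3) For $c=c_*$ there is a unique single-lobe solution $\eta\in C^0_{\rm per}(\mathbb T)\cap W^{1,\infty}(\mathbb T)$ of $(\ast)$. It is smooth and satisfies $(\ast)$ pointwise on $\mathbb R\setminus2\pi\mathbb Z$, and it is the $2\pi$-periodic extension of $$\eta(u)=\tfrac1{16}\left(\pi^2-4\pi|u|+2u^2\right),\qquad u\in[-\pi,\pi].$$ -/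

import Mathlib

open MeasureTheory Filter Topology Set

namespace StokesWave

/-- The threshold speed `c_* = π / (2 √2)`. -/
noncomputable def cStar : ℝ := Real.pi / (2 * Real.sqrt 2)

/-- Lebesgue measure on one period, i.e. on the torus `𝕋 = ℝ / 2πℤ`. -/
noncomputable def torusMeasure : Measure ℝ := volume.restrict (Ioc (-Real.pi) Real.pi)

/-- The lattice `2πℤ`, i.e. the point `0` of the torus. -/
def lattice : Set ℝ := {u | ∃ k : ℤ, u = 2 * Real.pi * (k : ℝ)}

/-- A single-lobe profile: `2π`-periodic, even, and with a single maximum on the torus, placed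
at `u = 0` (the local maximum points on the line are exactly the points of `2πℤ`). -/
structure IsSingleLobe (η : ℝ → ℝ) : Prop where
  periodic : Function.Periodic η (2 * Real.pi)
  even : Function.Even η
  isLocalMax_iff : ∀ u : ℝ, IsLocalMax η u ↔ u ∈ lattice

/-- `η` is smooth at `u` and satisfies `(c² - 2η) η'' - (η')² + η = 0` there. -/
def IsClassicalSolutionAt (c : ℝ) (η : ℝ → ℝ) (u : ℝ) : Prop :=
  ContDiffAt ℝ ((⊤ : ℕ∞) : WithTop ℕ∞) η u ∧
    (c ^ 2 - 2 * η u) * deriv (deriv η) u - (deriv η u) ^ 2 + η u = 0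

/-- Smooth `2π`-periodic test functions. -/
structure IsTestFunction (φ : ℝ → ℝ) : Prop where
  smooth : ContDiff ℝ ((⊤ : ℕ∞) : WithTop ℕ∞) φ
  periodic : Function.Periodic φ (2 * Real.pi)

/-- `g` is the weak derivative of `η` on the torus. -/
def HasWeakDeriv (η g : ℝ → ℝ) : Prop :=
  Integrable η torusMeasure ∧ Integrable g torusMeasure ∧
    ∀ φ : ℝ → ℝ, IsTestFunction φ →
      ∫ u, η u * deriv φ u ∂torusMeasure = - ∫ u, g u * φ u ∂torusMeasure

/-- Continuous profile of class `H¹_per(𝕋)` solving `(c² - 2η) η'' - (η')² + η = 0` in its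
divergence form `((c² - 2η) η')' + (η')² + η = 0`, tested against smooth periodic functions. -/
def IsWeakSolution (c : ℝ) (η : ℝ → ℝ) : Prop :=
  Continuous η ∧ Function.Periodic η (2 * Real.pi) ∧
    ∃ g : ℝ → ℝ, HasWeakDeriv η g ∧ MemLp g 2 torusMeasure ∧
      ∀ φ : ℝ → ℝ, IsTestFunction φ →
        ∫ u, ((c ^ 2 - 2 * η u) * g u * deriv φ u - (g u) ^ 2 * φ u - η u * φ u)
          ∂torusMeasure = 0

/-- The class `W^{1,∞}(𝕋)`. -/
def MemW1Infty (η : ℝ → ℝ) : Prop :=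
  MemLp η ⊤ torusMeasure ∧ ∃ g : ℝ → ℝ, HasWeakDeriv η g ∧ MemLp g ⊤ torusMeasure

/-- A single-lobe solution with profile in `C^∞_per(𝕋)`. -/
def IsSmoothWave (c : ℝ) (η : ℝ → ℝ) : Prop :=
  IsSingleLobe η ∧ ContDiff ℝ ((⊤ : ℕ∞) : WithTop ℕ∞) η ∧
    ∀ u : ℝ, IsClassicalSolutionAt c η u

/-- A single-lobe solution with profile in `C^0_per(𝕋)`, solving the equation weakly. -/
def IsContinuousWave (c : ℝ) (η : ℝ → ℝ) : Prop :=
  IsSingleLobe η ∧ IsWeakSolution c η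

end StokesWave

/-! The equation has the first integral η² + (c² − 2η)η'². While c² − 2η > 0, the new time φ with du
= √(c² − 2η) dφ turns it into the harmonic oscillator, so a smooth wave is η = a cos φ with 0 < a <
c²/2, and period 2π in u becomes `halfPeriod c a` = π. By concavity of the square root the half
period decreases strictly in a, from cπ at a = 0 to 2√2 c at a = c²/2. Hence the range 1 < c < c_*,
uniqueness of the amplitude, and amplitude tending to 0 as c → 1.

A crest at the critical level c²/2 is reached when the energy is c⁴(m − 1)²/4 with m ≥ 2. The
substitution η = c²/2 − (c²m/2) sin² t uniformises the orbit, with clock du/dt = `cuspDensity c m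
t`. For m > 2 the clock vanishes to second order at t = 0, so u behaves like t³ and η has a
|u|^(2/3) cusp. For m = 2 it vanishes to first order and the cusp becomes a corner. The half period
is c · `cuspHalfPeriod m`; it equals 2√2 c at m = 2 and `cuspHalfPeriod` takes a smaller value at
some m > 2, so the intermediate value theorem covers all speeds slightly above c_*. Both families
are handled by `IsClock`, which inverts the time map.

The flux q = (c² − 2η)η' satisfies q' = −η'² − η. It is continuous across the crests, so the
singular profiles are weak solutions (`weak_of_classical`). Conversely, du Bois-Reymond's lemma
gives every weak solution a continuous flux (`IsWeakSolution.exists_flux`), hence the system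
`IsFluxSystem` away from the critical level. At c = c_* a crest below c²/2 would be smooth and have
too long a period, a crest above it contradicts monotonicity, and for a crest at c²/2 bounded slope
fixes the energy to c⁴/4, which leaves a first-order equation solved explicitly. -/

namespace StokesWave

/-! ### Periodic even profiles -/

theorem exists_reduction (u : ℝ) :
    ∃ v ∈ Icc 0 Real.pi, ∃ k : ℤ, u = v + k * (2 * Real.pi) ∨ u = -v + k * (2 * Real.pi) := by
  have hp := Real.pi_pos
  set k := round (u / (2 * Real.pi))
  have h := abs_sub_round (u / (2 * Real.pi))
  have h' : |u - k * (2 * Real.pi)| ≤ Real.pi := by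
    have : u - k * (2 * Real.pi) = (u / (2 * Real.pi) - k) * (2 * Real.pi) := by
      field_simp
    rw [this, abs_mul, abs_of_pos (by positivity : 0 < 2 * Real.pi)]
    nlinarith
  refine ⟨|u - k * (2 * Real.pi)|, ⟨abs_nonneg _, h'⟩, k, ?_⟩
  rcases abs_cases (u - k * (2 * Real.pi)) with h | h
  · left; linarith
  · right; linarith

theorem apply_reduction {η : ℝ → ℝ} (hp : Function.Periodic η (2 * Real.pi))
    (he : Function.Even η) {u v : ℝ} {k : ℤ}
    (h : u = v + k * (2 * Real.pi) ∨ u = -v + k * (2 * Real.pi)) : η u = η v := by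
  rcases h with rfl | rfl
  · exact hp.int_mul k v
  · rw [hp.int_mul k (-v), he v]

theorem eq_of_eqOn_of_periodic_of_even {η ζ : ℝ → ℝ} (hη : Function.Periodic η (2 * Real.pi))
    (hη' : Function.Even η) (hζ : Function.Periodic ζ (2 * Real.pi)) (hζ' : Function.Even ζ)
    (h : ∀ u ∈ Icc 0 Real.pi, η u = ζ u) : η = ζ := by
  funext u
  obtain ⟨v, hv, k, hk⟩ := exists_reduction u
  rw [apply_reduction hη hη' hk, apply_reduction hζ hζ' hk, h v hv]

theorem zero_mem_lattice : (0 : ℝ) ∈ lattice := ⟨0, by simp⟩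

theorem int_mul_mem_lattice (k : ℤ) : k * (2 * Real.pi) ∈ lattice := ⟨k, by ring⟩

theorem countable_lattice : lattice.Countable := by
  have : lattice = range fun k : ℤ => 2 * Real.pi * (k : ℝ) := by
    ext u; simp [lattice, eq_comm]
  rw [this]
  exact countable_range _

theorem notMem_lattice_of_mem_Ioo {u : ℝ} (hu : u ∈ Ioo 0 (2 * Real.pi)) : u ∉ lattice := by
  rintro ⟨k, rfl⟩
  have hp := Real.pi_pos
  have h1 : (0 : ℝ) < k := by
    by_contra! h
    nlinarith [hu.1]
  have h2 : (k : ℝ) < 1 := by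
    by_contra! h
    nlinarith [hu.2]
  have h3 : 0 < k := by exact_mod_cast h1
  have h4 : k < 1 := by exact_mod_cast h2
  omega

theorem notMem_lattice_of_abs {u : ℝ} (h0 : u ≠ 0) (hu : |u| ≤ Real.pi) : u ∉ lattice := by
  have hp := Real.pi_pos
  have h1 : |u| ∉ lattice :=
    notMem_lattice_of_mem_Ioo ⟨abs_pos.2 h0, by linarith⟩
  rintro ⟨k, hk⟩
  rcases abs_cases u with h | h
  · exact h1 ⟨k, by rw [h.1, hk]⟩
  · exact h1 ⟨-k, by rw [h.1, hk]; push_cast; ring⟩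

theorem apply_le_zero_of_strictAntiOn {η : ℝ → ℝ} (hp : Function.Periodic η (2 * Real.pi))
    (he : Function.Even η) (ha : StrictAntiOn η (Icc 0 Real.pi)) (u : ℝ) : η u ≤ η 0 := by
  obtain ⟨v, hv, k, hk⟩ := exists_reduction u
  rw [apply_reduction hp he hk]
  exact ha.antitoneOn ⟨le_rfl, Real.pi_pos.le⟩ hv hv.1

/-- At a point folded into (0, π], a small step towards the crest strictly raises the value, so
local maxima occur only on the lattice. -/
theorem isSingleLobe_of_strictAntiOn {η : ℝ → ℝ} (hp : Function.Periodic η (2 * Real.pi))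
    (he : Function.Even η) (ha : StrictAntiOn η (Icc 0 Real.pi)) : IsSingleLobe η := by
  refine ⟨hp, he, fun u => ⟨fun h => ?_, ?_⟩⟩
  · obtain ⟨v, hv, k, hk⟩ := exists_reduction u
    rcases hv.1.eq_or_lt with rfl | hv0
    · rcases hk with rfl | rfl
      · simpa using int_mul_mem_lattice k
      · simpa using int_mul_mem_lattice k
    exfalso
    obtain ⟨ε, hε, H⟩ := Metric.eventually_nhds_iff.1 h
    set d := min (ε / 2) v
    have hd : 0 < d := by positivity
    have hdv : d ≤ v := min_le_right _ _
    have hdε : d < ε := (min_le_left _ _).trans_lt (by linarith)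
    have hlt : η v < η (v - d) := ha ⟨by linarith, by linarith [hv.2]⟩ hv (by linarith)
    have key : ∀ y : ℝ, |y - u| = d →
        (y = (v - d) + k * (2 * Real.pi) ∨ y = -(v - d) + k * (2 * Real.pi)) → False := by
      intro y hy hy'
      have := H (by rw [Real.dist_eq, hy]; exact hdε)
      rw [apply_reduction hp he hk, apply_reduction hp he hy'] at this
      linarith
    rcases hk with hk | hk
    · refine key (u - d) ?_ (Or.inl (by rw [hk]; ring))
      rw [show u - d - u = -d by ring, abs_neg, abs_of_pos hd]
    · refine key (u + d) ?_ (Or.inr (by rw [hk]; ring))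
      rw [show u + d - u = d by ring, abs_of_pos hd]
  · rintro ⟨k, rfl⟩
    have : η (2 * Real.pi * k) = η 0 := by
      have := hp.int_mul k 0
      rw [← this]; congr 1; ring
    refine Eventually.of_forall fun y => ?_
    rw [this]
    exact apply_le_zero_of_strictAntiOn hp he ha y

/-- If ζ x ≤ ζ y with x < y ≤ π, then on [x, 2π − x], whose two endpoint values agree by symmetry, a
maximum is attained in the interior. That is a local maximum off the lattice. -/
theorem IsSingleLobe.strictAntiOn {ζ : ℝ → ℝ} (h : IsSingleLobe ζ) (hc : Continuous ζ) :
    StrictAntiOn ζ (Icc 0 Real.pi) := by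
  intro x hx y hy hxy
  by_contra! hle
  have hp := Real.pi_pos
  have hsymm : ζ (2 * Real.pi - x) = ζ x := by
    rw [show 2 * Real.pi - x = -x + 2 * Real.pi by ring, h.periodic, h.even]
  have hyI : y ∈ Ioo x (2 * Real.pi - x) := ⟨hxy, by linarith [hx.2, hy.2]⟩
  have no_max : ∀ z ∈ Ioo x (2 * Real.pi - x), ¬ IsMaxOn ζ (Icc x (2 * Real.pi - x)) z := by
    intro z hz hmax
    have hloc : IsLocalMax ζ z := hmax.isLocalMax (Icc_mem_nhds hz.1 hz.2)
    exact notMem_lattice_of_mem_Ioo ⟨hx.1.trans_lt hz.1, hz.2.trans_le (by linarith [hx.1])⟩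
      ((h.isLocalMax_iff z).1 hloc)
  obtain ⟨z, hz, hmax⟩ := isCompact_Icc.exists_isMaxOn
    (⟨y, Ioo_subset_Icc_self hyI⟩ : (Icc x (2 * Real.pi - x)).Nonempty) hc.continuousOn
  by_cases hzI : z ∈ Ioo x (2 * Real.pi - x)
  · exact no_max z hzI hmax
  · have hzx : ζ z = ζ x := by
      rcases hz.1.eq_or_lt with h1 | h1
      · rw [← h1]
      · rcases hz.2.eq_or_lt with h2 | h2
        · rw [h2, hsymm]
        · exact absurd ⟨h1, h2⟩ hzI
    refine no_max y hyI fun t ht => ?_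
    have : ζ t ≤ ζ z := hmax ht
    change ζ t ≤ ζ y
    linarith

/-! ### Reparametrization by the inverse of a primitive -/

/-- A continuous even `2L`-periodic density `p ≥ 0` with countably many zeros and integral `π`
over a half period. -/
structure IsClock (L : ℝ) (p : ℝ → ℝ) : Prop where
  pos : 0 < L
  continuous : Continuous p
  even : Function.Even p
  periodic : Function.Periodic p (2 * L)
  nonneg : ∀ t, 0 ≤ p t
  countable : {t | p t = 0}.Countable
  integral : ∫ t in (0 : ℝ)..L, p t = Real.pi

/-- The primitive of `p` vanishing at `0`. -/
noncomputable def time (p : ℝ → ℝ) (φ : ℝ) : ℝ := ∫ t in (0 : ℝ)..φ, p t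

theorem time_zero (p : ℝ → ℝ) : time p 0 = 0 := by simp [time]

theorem hasDerivAt_time {p : ℝ → ℝ} (hp : Continuous p) (φ : ℝ) :
    HasDerivAt (time p) (p φ) φ :=
  intervalIntegral.integral_hasDerivAt_right (hp.intervalIntegrable _ _)
    (hp.stronglyMeasurableAtFilter _ _) hp.continuousAt

/-- Countably many zeros are allowed because the singular clock vanishes at every crest. No interval
of positive length lies in a countable set. -/
theorem strictMono_time {p : ℝ → ℝ} (hp : Continuous p) (h0 : ∀ t, 0 ≤ p t)
    (hc : {t | p t = 0}.Countable) : StrictMono (time p) := by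
  intro x y hxy
  have hpos : 0 < ∫ t in x..y, p t := by
    refine intervalIntegral.integral_pos hxy hp.continuousOn (fun t _ => h0 t) ?_
    by_contra! hle
    have hsub : Icc x y ⊆ {t | p t = 0} := fun t ht => le_antisymm (hle t ht) (h0 t)
    exact Cardinal.Real.Icc_countable_iff.not.2 (not_le.2 hxy) (hc.mono hsub)
  have := intervalIntegral.integral_add_adjacent_intervals (hp.intervalIntegrable (μ := volume) 0 x)
    (hp.intervalIntegrable x y)
  simp only [time]
  linarith

theorem contDiffAt_time {p : ℝ → ℝ} (hp : Continuous p) {φ : ℝ}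
    (hs : ContDiffAt ℝ ((⊤ : ℕ∞) : WithTop ℕ∞) p φ) :
    ContDiffAt ℝ ((⊤ : ℕ∞) : WithTop ℕ∞) (time p) φ := by
  rw [contDiffAt_infty]
  intro n
  have : ContDiffAt ℝ ((n : WithTop ℕ∞) + 1) (time p) φ := by
    rw [contDiffAt_succ_iff_hasFDerivAt]
    refine ⟨fun x => ContinuousLinearMap.toSpanSingleton ℝ (p x), ⟨univ, univ_mem, fun x _ =>
      (hasDerivAt_time hp x).hasFDerivAt⟩, ?_⟩
    have h1 : ContDiffAt ℝ n p φ := hs.of_le (by exact_mod_cast le_top)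
    exact (ContinuousLinearMap.toSpanSingletonCLE (𝕜 := ℝ) (E := ℝ)).contDiff.contDiffAt.comp φ h1
  exact this.of_le (by exact_mod_cast Nat.le_succ n)

namespace IsClock

variable {L : ℝ} {p : ℝ → ℝ}

theorem strictMono (h : IsClock L p) : StrictMono (time p) :=
  strictMono_time h.continuous h.nonneg h.countable

theorem time_neg (h : IsClock L p) (φ : ℝ) : time p (-φ) = -time p φ := by
  have := intervalIntegral.integral_comp_neg (a := 0) (b := φ) p
  simp only [time]
  rw [intervalIntegral.integral_symm, ← neg_zero, ← this]
  simp [h.even _]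

theorem time_add (h : IsClock L p) (φ : ℝ) : time p (φ + 2 * L) = time p φ + 2 * Real.pi := by
  have hi : ∀ a b, IntervalIntegrable p volume a b := fun a b => h.continuous.intervalIntegrable a b
  have h1 := h.periodic.intervalIntegral_add_eq φ (-L)
  have h2 : ∫ t in (-L)..L, p t = 2 * Real.pi := by
    rw [← intervalIntegral.integral_add_adjacent_intervals (hi (-L) 0) (hi 0 L), h.integral]
    have := h.time_neg L
    rw [time, intervalIntegral.integral_symm, time, h.integral] at this
    linarith
  rw [show -L + 2 * L = L by ring, h2] at h1
  rw [time, time, ← intervalIntegral.integral_add_adjacent_intervals (hi 0 φ) (hi φ (φ + 2 * L)),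
    h1]

theorem time_half (h : IsClock L p) : time p L = Real.pi := h.integral

theorem time_nat_mul (h : IsClock L p) (n : ℕ) : time p (n * (2 * L)) = n * (2 * Real.pi) := by
  induction n with
  | zero => simp [time]
  | succ n ih =>
    rw [Nat.cast_succ, add_mul, one_mul, h.time_add, ih]; ring

theorem surjective (h : IsClock L p) : Function.Surjective (time p) := by
  have hc : Continuous (time p) :=
    continuous_iff_continuousAt.2 fun x => (hasDerivAt_time h.continuous x).continuousAt
  intro y
  have hp := Real.pi_pos
  obtain ⟨n, hn⟩ := exists_nat_gt (|y| / (2 * Real.pi))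
  rw [div_lt_iff₀ (by positivity)] at hn
  obtain ⟨h1, h2⟩ := abs_le.1 hn.le
  refine mem_range_of_exists_le_of_exists_ge hc ⟨-(n * (2 * L)), ?_⟩ ⟨n * (2 * L), ?_⟩
  · rw [h.time_neg, h.time_nat_mul]; exact h1
  · rw [h.time_nat_mul]; exact h2

/-- `time p` as an order isomorphism of the line. -/
noncomputable def iso (h : IsClock L p) : ℝ ≃o ℝ :=
  h.strictMono.orderIsoOfSurjective (time p) h.surjective

/-- The inverse of `time p`. -/
noncomputable def phase (h : IsClock L p) (u : ℝ) : ℝ := h.iso.symm u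

theorem time_phase (h : IsClock L p) (u : ℝ) : time p (h.phase u) = u :=
  h.iso.apply_symm_apply u

theorem phase_time (h : IsClock L p) (φ : ℝ) : h.phase (time p φ) = φ :=
  h.iso.symm_apply_apply φ

theorem continuous_phase (h : IsClock L p) : Continuous h.phase := h.iso.symm.continuous

theorem strictMono_phase (h : IsClock L p) : StrictMono h.phase := h.iso.symm.strictMono

theorem phase_zero (h : IsClock L p) : h.phase 0 = 0 := by
  simpa [time_zero] using h.phase_time 0

theorem phase_pi (h : IsClock L p) : h.phase Real.pi = L := by
  rw [← h.time_half, h.phase_time]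

theorem phase_neg (h : IsClock L p) (u : ℝ) : h.phase (-u) = -h.phase u := by
  apply h.strictMono.injective
  rw [h.time_neg, h.time_phase, h.time_phase]

theorem phase_add (h : IsClock L p) (u : ℝ) : h.phase (u + 2 * Real.pi) = h.phase u + 2 * L := by
  apply h.strictMono.injective
  rw [h.time_add, h.time_phase, h.time_phase]

theorem phase_int_mul (h : IsClock L p) (k : ℤ) : h.phase (k * (2 * Real.pi)) = k * (2 * L) := by
  -- Subtracting the linear part leaves a periodic function, so integer translates come from
  -- periodicity.
  have hper : Function.Periodic (fun u => h.phase u - u * (L / Real.pi)) (2 * Real.pi) := by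
    intro u
    simp only [h.phase_add]
    field_simp
    ring
  have := hper.int_mul k 0
  simp only [zero_add, h.phase_zero, zero_mul, sub_zero] at this
  have hp := Real.pi_pos
  rw [sub_eq_zero.1 this]
  field_simp

theorem phase_mem_Icc (h : IsClock L p) {u : ℝ} (hu : u ∈ Icc 0 Real.pi) : h.phase u ∈ Icc 0 L :=
  ⟨h.phase_zero.symm.le.trans (h.strictMono_phase.monotone hu.1),
    (h.strictMono_phase.monotone hu.2).trans h.phase_pi.le⟩

theorem hasDerivAt_phase (h : IsClock L p) {u : ℝ} (hu : p (h.phase u) ≠ 0) :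
    HasDerivAt h.phase (p (h.phase u))⁻¹ u :=
  HasDerivAt.of_local_left_inverse h.continuous_phase.continuousAt
    (hasDerivAt_time h.continuous _) hu (Eventually.of_forall h.time_phase)

theorem contDiffAt_phase (h : IsClock L p) {u : ℝ} (hu : p (h.phase u) ≠ 0)
    (hs : ContDiffAt ℝ ((⊤ : ℕ∞) : WithTop ℕ∞) p (h.phase u)) :
    ContDiffAt ℝ ((⊤ : ℕ∞) : WithTop ℕ∞) h.phase u :=
  h.iso.toHomeomorph.toOpenPartialHomeomorph.contDiffAt_symm_deriv hu (mem_univ u)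
    (hasDerivAt_time h.continuous _) (contDiffAt_time h.continuous hs)

theorem isSingleLobe_comp (h : IsClock L p) {f : ℝ → ℝ} (hf : Function.Even f)
    (hp : Function.Periodic f (2 * L)) (ha : StrictAntiOn f (Icc 0 L)) :
    IsSingleLobe fun u => f (h.phase u) := by
  refine isSingleLobe_of_strictAntiOn (fun u => ?_) (fun u => ?_) fun x hx y hy hxy => ?_
  · simp only [h.phase_add]; exact hp _
  · simp only [h.phase_neg]; exact hf _
  · exact ha (h.phase_mem_Icc hx) (h.phase_mem_Icc hy) (h.strictMono_phase hxy)

/-- If `η' = r ∘ phase` for `η = f ∘ phase`, the equation for `η` at `u` becomes an identity between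
`f`, `r` and `p`. -/
theorem isClassicalSolutionAt_comp (h : IsClock L p) {c : ℝ} {f r : ℝ → ℝ} {r' u : ℝ}
    (hu : p (h.phase u) ≠ 0)
    (hs : ContDiffAt ℝ ((⊤ : ℕ∞) : WithTop ℕ∞) p (h.phase u))
    (hf : ContDiff ℝ ((⊤ : ℕ∞) : WithTop ℕ∞) f)
    (hr : ∀ φ, p φ ≠ 0 → HasDerivAt f (r φ * p φ) φ) (hr' : HasDerivAt r r' (h.phase u))
    (heq : (c ^ 2 - 2 * f (h.phase u)) * (r' * (p (h.phase u))⁻¹) - r (h.phase u) ^ 2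
      + f (h.phase u) = 0) :
    IsClassicalSolutionAt c (fun u => f (h.phase u)) u := by
  have hd : ∀ v, p (h.phase v) ≠ 0 → HasDerivAt (fun u => f (h.phase u)) (r (h.phase v)) v := by
    intro v hv
    have := (hr _ hv).comp v (h.hasDerivAt_phase hv)
    rwa [mul_assoc, mul_inv_cancel₀ hv, mul_one] at this
  have hev : deriv (fun u => f (h.phase u)) =ᶠ[𝓝 u] fun v => r (h.phase v) := by
    have : ∀ᶠ v in 𝓝 u, p (h.phase v) ≠ 0 :=
      (h.continuous.comp h.continuous_phase).continuousAt.eventually_ne hu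
    filter_upwards [this] with v hv using (hd v hv).deriv
  refine ⟨hf.contDiffAt.comp u (h.contDiffAt_phase hu hs), ?_⟩
  have h2 : deriv (fun v => r (h.phase v)) u = r' * (p (h.phase u))⁻¹ :=
    (hr'.comp u (h.hasDerivAt_phase hu)).deriv
  rw [hev.deriv_eq, (hd u hu).deriv, h2]
  exact heq

end IsClock

/-! ### The smooth family -/

/-- The density of the angle clock of a smooth wave of amplitude `a` and speed `c`. -/
noncomputable def smoothDensity (c a t : ℝ) : ℝ := √(c ^ 2 - 2 * a * Real.cos t)

/-- The half period of the smooth wave of amplitude `a` and speed `c`. -/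
noncomputable def halfPeriod (c a : ℝ) : ℝ := ∫ t in (0 : ℝ)..Real.pi, smoothDensity c a t

theorem continuous_smoothDensity (c a : ℝ) : Continuous (smoothDensity c a) := by
  unfold smoothDensity; fun_prop

/-- The square of the sum is 2A + 2√(A² − x²), which decreases in x ≥ 0. -/
theorem sqrt_sub_add_sqrt_add_lt {A x y : ℝ} (hx : 0 ≤ x) (hxy : x < y) (hy : y ≤ A) :
    √(A - y) + √(A + y) < √(A - x) + √(A + x) := by
  have h1 := Real.sq_sqrt (show 0 ≤ A - y by linarith)
  have h2 := Real.sq_sqrt (show 0 ≤ A + y by linarith)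
  have h3 := Real.sq_sqrt (show 0 ≤ A - x by linarith)
  have h4 := Real.sq_sqrt (show 0 ≤ A + x by linarith)
  have h5 : √(A - y) * √(A + y) < √(A - x) * √(A + x) := by
    rw [← Real.sqrt_mul (by linarith), ← Real.sqrt_mul (by linarith)]
    exact Real.sqrt_lt_sqrt (by nlinarith) (by nlinarith)
  refine lt_of_pow_lt_pow_left₀ 2 (by positivity) ?_
  nlinarith

theorem sqrt_sub_add_sqrt_add_abs (A x : ℝ) :
    √(A - |x|) + √(A + |x|) = √(A - x) + √(A + x) := by
  rcases abs_cases x with h | h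
  · rw [h.1]
  · rw [h.1, sub_neg_eq_add, ← sub_eq_add_neg, add_comm]

/-- Averaging with the reflection t ↦ π − t makes the dependence on the amplitude monotone
pointwise, which it is not in the original integrand. -/
theorem two_mul_halfPeriod (c a : ℝ) : 2 * halfPeriod c a =
    ∫ t in (0 : ℝ)..Real.pi, (√(c ^ 2 - 2 * a * Real.cos t) + √(c ^ 2 + 2 * a * Real.cos t)) := by
  rw [intervalIntegral.integral_add (Continuous.intervalIntegrable (by fun_prop) _ _)
    (Continuous.intervalIntegrable (by fun_prop) _ _)]
  have := intervalIntegral.integral_comp_sub_left (a := 0) (b := Real.pi) (smoothDensity c a)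
    Real.pi
  simp only [sub_self, sub_zero, smoothDensity, Real.cos_pi_sub, mul_neg, sub_neg_eq_add] at this
  rw [this, halfPeriod]
  simp only [smoothDensity]
  ring

theorem strictAntiOn_halfPeriod (c : ℝ) : StrictAntiOn (halfPeriod c) (Icc 0 (c ^ 2 / 2)) := by
  intro a ha b hb hab
  have key : ∀ t, Real.cos t ≠ 0 →
      √(c ^ 2 - 2 * b * Real.cos t) + √(c ^ 2 + 2 * b * Real.cos t) <
      √(c ^ 2 - 2 * a * Real.cos t) + √(c ^ 2 + 2 * a * Real.cos t) := by
    intro t ht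
    have h0 : 0 < |Real.cos t| := abs_pos.2 ht
    have h1 := Real.abs_cos_le_one t
    rw [← sqrt_sub_add_sqrt_add_abs, ← sqrt_sub_add_sqrt_add_abs _ (2 * a * Real.cos t)]
    rw [abs_mul (2 * a), abs_mul (2 * b), abs_of_nonneg (by linarith [ha.1] : 0 ≤ 2 * a),
      abs_of_nonneg (by linarith [hb.1] : 0 ≤ 2 * b)]
    refine sqrt_sub_add_sqrt_add_lt (by nlinarith [ha.1]) (by nlinarith) ?_
    nlinarith [hb.2, hb.1]
  have h : 2 * halfPeriod c b < 2 * halfPeriod c a := by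
    rw [two_mul_halfPeriod, two_mul_halfPeriod]
    refine intervalIntegral.integral_lt_integral_of_continuousOn_of_le_of_exists_lt Real.pi_pos
      (by fun_prop) (by fun_prop) (fun t _ => ?_) ⟨0, ⟨le_rfl, Real.pi_pos.le⟩, key 0 (by simp)⟩
    by_cases ht : Real.cos t = 0
    · simp [ht]
    · exact (key t ht).le
  linarith

theorem continuous_halfPeriod : Continuous fun q : ℝ × ℝ => halfPeriod q.1 q.2 := by
  refine intervalIntegral.continuous_parametric_intervalIntegral_of_continuous' ?_ _ _
  simp only [smoothDensity, Function.uncurry_def]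
  fun_prop

theorem halfPeriod_zero {c : ℝ} (hc : 0 ≤ c) : halfPeriod c 0 = c * Real.pi := by
  simp [halfPeriod, smoothDensity, Real.sqrt_sq hc, mul_comm]

/-- At the extreme amplitude the radicand is the perfect square 2c² sin²(t/2). Setting this half
period equal to π gives the threshold c_*. -/
theorem halfPeriod_max {c : ℝ} (hc : 0 ≤ c) : halfPeriod c (c ^ 2 / 2) = 2 * √2 * c := by
  have h : ∀ t ∈ uIcc 0 Real.pi, smoothDensity c (c ^ 2 / 2) t = √2 * c * Real.sin (t / 2) := by
    intro t ht
    rw [uIcc_of_le Real.pi_pos.le] at ht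
    have hs : 0 ≤ Real.sin (t / 2) :=
      Real.sin_nonneg_of_nonneg_of_le_pi (by linarith [ht.1]) (by linarith [ht.2, Real.pi_pos])
    have : c ^ 2 - 2 * (c ^ 2 / 2) * Real.cos t = (√2 * c * Real.sin (t / 2)) ^ 2 := by
      rw [mul_pow, mul_pow, Real.sq_sqrt (by norm_num)]
      have := Real.cos_sq (t / 2)
      rw [mul_div_cancel₀ _ two_ne_zero] at this
      have h2 := Real.sin_sq_add_cos_sq (t / 2)
      linear_combination (-2 * c ^ 2) * h2 + (2 * c ^ 2) * this
    rw [smoothDensity, this, Real.sqrt_sq (by positivity)]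
  rw [halfPeriod, intervalIntegral.integral_congr h, intervalIntegral.integral_const_mul]
  have := intervalIntegral.integral_comp_div (a := 0) (b := Real.pi) Real.sin two_ne_zero
  rw [this]
  simp
  ring

theorem two_sqrt_two_mul_cStar : 2 * √2 * cStar = Real.pi := by
  rw [cStar]
  field_simp

theorem one_lt_cStar : 1 < cStar := by
  have h : √2 < 1.5 := by
    rw [Real.sqrt_lt' (by norm_num)]; norm_num
  rw [cStar, one_lt_div (by positivity)]
  linarith [Real.pi_gt_three]

theorem two_mul_mul_cos_lt {c a : ℝ} (ha : a ∈ Ioo 0 (c ^ 2 / 2)) (t : ℝ) :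
    0 < c ^ 2 - 2 * a * Real.cos t := by
  nlinarith [ha.1, ha.2, Real.cos_le_one t]

theorem smoothDensity_pos {c a : ℝ} (ha : a ∈ Ioo 0 (c ^ 2 / 2)) (t : ℝ) :
    0 < smoothDensity c a t := Real.sqrt_pos.2 (two_mul_mul_cos_lt ha t)

theorem countable_smoothDensity_eq_zero {c a : ℝ} (ha : a ∈ Ioo 0 (c ^ 2 / 2)) :
    {t | smoothDensity c a t = 0}.Countable := by
  have : {t | smoothDensity c a t = 0} = ∅ :=
    eq_empty_of_forall_notMem fun t ht => (smoothDensity_pos ha t).ne' ht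
  rw [this]
  exact countable_empty

theorem strictMono_time_smoothDensity {c a : ℝ} (ha : a ∈ Ioo 0 (c ^ 2 / 2)) :
    StrictMono (time (smoothDensity c a)) :=
  strictMono_time (continuous_smoothDensity c a) (fun t => (smoothDensity_pos ha t).le)
    (countable_smoothDensity_eq_zero ha)

theorem isClock_smoothDensity {c a : ℝ} (ha : a ∈ Ioo 0 (c ^ 2 / 2))
    (h : halfPeriod c a = Real.pi) : IsClock Real.pi (smoothDensity c a) where
  pos := Real.pi_pos
  continuous := continuous_smoothDensity c a
  even t := by simp [smoothDensity]
  periodic t := by simp [smoothDensity]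
  nonneg t := (smoothDensity_pos ha t).le
  countable := countable_smoothDensity_eq_zero ha
  integral := h

theorem isSmoothWave_smooth {c a : ℝ} (ha : a ∈ Ioo 0 (c ^ 2 / 2))
    (h : halfPeriod c a = Real.pi) :
    IsSmoothWave c fun u => a * Real.cos ((isClock_smoothDensity ha h).phase u) := by
  have hC := isClock_smoothDensity ha h
  have hp := fun t => (smoothDensity_pos ha t).ne'
  have hcl : ∀ u, IsClassicalSolutionAt c (fun u => a * Real.cos (hC.phase u)) u := by
    intro u
    set p := smoothDensity c a
    set φ := hC.phase u
    have hsq : p φ ^ 2 = c ^ 2 - 2 * a * Real.cos φ := Real.sq_sqrt (two_mul_mul_cos_lt ha φ).le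
    have hd : HasDerivAt p (a * Real.sin φ / p φ) φ := by
      have h1 : HasDerivAt (fun t => c ^ 2 - 2 * a * Real.cos t) (2 * a * Real.sin φ) φ := by
        convert! ((Real.hasDerivAt_cos φ).const_mul (2 * a)).const_sub (c ^ 2) using 1
        ring
      convert! h1.sqrt (two_mul_mul_cos_lt ha φ).ne' using 1
      change _ = _ / (2 * p φ)
      have := hp φ
      field_simp
    refine hC.isClassicalSolutionAt_comp (f := fun t => a * Real.cos t)
      (r := fun t => -(a * Real.sin t) / p t)
      (r' := (-(a * Real.cos φ) * p φ - -(a * Real.sin φ) * (a * Real.sin φ / p φ)) / p φ ^ 2)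
      (hp _) ?_ ?_ ?_ ?_ ?_
    · refine ContDiffAt.sqrt (ContDiff.contDiffAt ?_) (two_mul_mul_cos_lt ha _).ne'
      fun_prop
    · fun_prop
    · intro t ht
      convert! (Real.hasDerivAt_cos t).const_mul a using 1
      field_simp
    · exact (((Real.hasDerivAt_sin φ).const_mul a).neg).div hd (hp φ)
    · have h0 : p φ ≠ 0 := hp φ
      change (c ^ 2 - 2 * (a * Real.cos φ)) * (_ * (p φ)⁻¹) - (-(a * Real.sin φ) / p φ) ^ 2
        + a * Real.cos φ = 0
      rw [show c ^ 2 - 2 * (a * Real.cos φ) = p φ ^ 2 by rw [hsq]; ring]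
      field_simp
      ring
  refine ⟨hC.isSingleLobe_comp (f := fun t => a * Real.cos t) (fun t => by simp)
    (fun t => by simp) ?_, contDiff_iff_contDiffAt.2 fun u => (hcl u).1, hcl⟩
  intro x hx y hy hxy
  exact mul_lt_mul_of_pos_left (Real.strictAntiOn_cos hx hy hxy) ha.1

theorem exists_halfPeriod_eq {c : ℝ} (hc : c ∈ Ioo 1 cStar) :
    ∃ a ∈ Ioo 0 (c ^ 2 / 2), halfPeriod c a = Real.pi := by
  have hc0 : 0 < c := by linarith [hc.1]
  have hcont : ContinuousOn (halfPeriod c) (Icc 0 (c ^ 2 / 2)) :=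
    (continuous_halfPeriod.comp (by fun_prop : Continuous fun a : ℝ => (c, a))).continuousOn
  have hpi := Real.pi_pos
  have h := intermediate_value_Ioo' (by positivity) hcont
  refine h ⟨?_, ?_⟩
  · rw [halfPeriod_max hc0.le, ← two_sqrt_two_mul_cStar]
    exact mul_lt_mul_of_pos_left hc.2 (by positivity)
  · rw [halfPeriod_zero hc0.le]
    nlinarith [hc.1]

/-- The amplitudes of the smooth waves tend to `0` at the linear speed `1`. -/
theorem tendsto_amplitude {a : ℝ → ℝ}
    (ha : ∀ c ∈ Ioo 1 cStar, a c ∈ Ioo 0 (c ^ 2 / 2) ∧ halfPeriod c (a c) = Real.pi) :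
    Tendsto a (𝓝[>] 1) (𝓝 0) := by
  have hev : ∀ᶠ c in 𝓝[>] (1 : ℝ), c ∈ Ioo 1 cStar := Ioo_mem_nhdsGT one_lt_cStar
  refine tendsto_order.2 ⟨fun b hb => ?_, fun b hb => ?_⟩
  · filter_upwards [hev] with c hc using hb.trans (ha c hc).1.1
  -- The cap 1/4 keeps e below c²/2 for every c ≥ 1, where monotonicity of the half period is
  -- available.
  · set e := min b (1 / 4)
    have he : 0 < e := by positivity
    have he' : e ≤ 1 / 4 := min_le_right _ _
    have h1 : halfPeriod 1 e < Real.pi := by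
      have := strictAntiOn_halfPeriod 1 (a := 0) (b := e) ⟨le_rfl, by norm_num⟩
        ⟨he.le, by norm_num; linarith⟩ he
      rwa [halfPeriod_zero zero_le_one, one_mul] at this
    have h2 : ∀ᶠ c in 𝓝[>] (1 : ℝ), halfPeriod c e < Real.pi := by
      have hcont : Continuous fun c => halfPeriod c e :=
        continuous_halfPeriod.comp (by fun_prop : Continuous fun c : ℝ => (c, e))
      exact (hcont.tendsto 1).mono_left nhdsWithin_le_nhds |>.eventually_lt_const h1
    filter_upwards [hev, h2] with c hc hlt
    refine lt_of_lt_of_le ?_ (min_le_left b (1 / 4))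
    by_contra! hle
    have hac := ha c hc
    have := (strictAntiOn_halfPeriod c).antitoneOn (a := e) (b := a c)
      ⟨he.le, by nlinarith [hc.1]⟩ ⟨hac.1.1.le, hac.1.2.le⟩ hle
    linarith [hac.2]

/-! ### Classical solutions off the lattice are weak solutions -/

theorem integral_torusMeasure (f : ℝ → ℝ) :
    ∫ u, f u ∂torusMeasure = ∫ u in (-Real.pi)..Real.pi, f u := by
  rw [torusMeasure, intervalIntegral.integral_of_le (by linarith [Real.pi_pos])]

theorem integrable_torusMeasure {f : ℝ → ℝ} :
    Integrable f torusMeasure ↔ IntervalIntegrable f volume (-Real.pi) Real.pi := by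
  rw [intervalIntegrable_iff_integrableOn_Ioc_of_le (by linarith [Real.pi_pos])]
  rfl

instance : IsFiniteMeasure torusMeasure := by
  unfold torusMeasure
  infer_instance

theorem _root_.Function.Periodic.apply_neg_pi {f : ℝ → ℝ}
    (hf : Function.Periodic f (2 * Real.pi)) : f (-Real.pi) = f Real.pi := by
  rw [← hf]; congr 1; ring

theorem IsTestFunction.hasDerivAt {φ : ℝ → ℝ} (hφ : IsTestFunction φ) (u : ℝ) :
    HasDerivAt φ (deriv φ u) u :=
  (hφ.smooth.differentiable (by simp) u).hasDerivAt

theorem IsTestFunction.continuous_deriv {φ : ℝ → ℝ} (hφ : IsTestFunction φ) :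
    Continuous (deriv φ) :=
  hφ.smooth.continuous_deriv (by exact_mod_cast le_top)

theorem IsClassicalSolutionAt.hasDerivAt {c u : ℝ} {η : ℝ → ℝ} (h : IsClassicalSolutionAt c η u) :
    HasDerivAt η (deriv η u) u :=
  (h.1.differentiableAt (by simp)).hasDerivAt

theorem IsClassicalSolutionAt.hasDerivAt_flux {c u : ℝ} {η : ℝ → ℝ}
    (h : IsClassicalSolutionAt c η u) :
    HasDerivAt (fun v => (c ^ 2 - 2 * η v) * deriv η v) (-deriv η u ^ 2 - η u) u := by
  have h1 : ContDiffAt ℝ 1 (deriv η) u := by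
    have h2 : ContDiffAt ℝ 1 (fderiv ℝ η) u := h.1.fderiv_right (by norm_cast)
    exact h2.clm_apply contDiffAt_const
  have h2 := (h1.differentiableAt one_ne_zero).hasDerivAt
  convert! ((h.hasDerivAt.const_mul 2).const_sub (c ^ 2)).mul h2 using 1
  linear_combination -h.2

/-- The lattice is countable and η and the flux are continuous across it, so integration by parts
creates no boundary terms at the crests. -/
theorem weak_of_classical {c : ℝ} {η : ℝ → ℝ} (hη : Continuous η)
    (hper : Function.Periodic η (2 * Real.pi))
    (hq : Continuous fun u => (c ^ 2 - 2 * η u) * deriv η u)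
    (hcl : ∀ u ∉ lattice, IsClassicalSolutionAt c η u) :
    IsWeakSolution c η ∧ HasWeakDeriv η (deriv η) := by
  have hpi := Real.pi_pos
  set q := fun u => (c ^ 2 - 2 * η u) * deriv η u with hqdef
  have hqper : q (-Real.pi) = q Real.pi := by
    have h1 : Function.Periodic (deriv η) (2 * Real.pi) := by
      intro u
      rw [← deriv_comp_add_const]
      congr 1
      funext v
      exact hper v
    have : Function.Periodic q (2 * Real.pi) := fun u => by simp only [hqdef, hper u, h1 u]
    exact this.apply_neg_pi
  have hint : ∀ a b, (∀ u ∈ Ioo (min a b) (max a b), u ∉ lattice) →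
      IntervalIntegrable (fun u => deriv η u ^ 2) volume a b := by
    intro a b hab
    -- By the flux equation (η')² is the derivative of −q − ∫η, which is continuous up to the
    -- crests. A nonnegative derivative of a continuous function is integrable, so no bound on η' is
    -- needed.
    refine intervalIntegral.intervalIntegrable_deriv_of_nonneg
      (g := fun u => -q u - time η u) ?_ (fun u hu => ?_) fun u _ => sq_nonneg _
    · have : Continuous (time η) :=
        continuous_iff_continuousAt.2 fun x => (hasDerivAt_time hη x).continuousAt
      fun_prop
    · convert! ((hcl u (hab u hu)).hasDerivAt_flux.neg).sub (hasDerivAt_time hη u) using 1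
      ring
  have hsq : IntervalIntegrable (fun u => deriv η u ^ 2) volume (-Real.pi) Real.pi := by
    refine (hint (-Real.pi) 0 fun u hu => ?_).trans (hint 0 Real.pi fun u hu => ?_)
    · rw [min_eq_left (by linarith), max_eq_right (by linarith)] at hu
      exact notMem_lattice_of_abs hu.2.ne (by rw [abs_of_neg hu.2]; linarith [hu.1])
    · rw [min_eq_left hpi.le, max_eq_right hpi.le] at hu
      exact notMem_lattice_of_abs hu.1.ne' (by rw [abs_of_pos hu.1]; linarith [hu.2])
  have hL2 : MemLp (deriv η) 2 torusMeasure :=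
    (memLp_two_iff_integrable_sq (measurable_deriv η).aestronglyMeasurable).2
      (integrable_torusMeasure.2 hsq)
  have hderiv := hL2.integrable (by norm_num)
  have hderiv' := integrable_torusMeasure.1 hderiv
  have hηi : ∀ a b, IntervalIntegrable η volume a b := fun a b => hη.intervalIntegrable a b
  have hweak : HasWeakDeriv η (deriv η) := by
    refine ⟨integrable_torusMeasure.2 (hηi _ _), hderiv, fun φ hφ => ?_⟩
    have hφc := hφ.smooth.continuous
    have i1 : IntervalIntegrable (fun u => η u * deriv φ u) volume (-Real.pi) Real.pi :=
      (hη.mul hφ.continuous_deriv).intervalIntegrable _ _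
    have i2 := hderiv'.mul_continuousOn hφc.continuousOn
    have := integral_eq_of_hasDerivAt_off_countable_of_le (fun u => η u * φ u)
      (fun u => deriv η u * φ u + η u * deriv φ u) (by linarith : -Real.pi ≤ Real.pi)
      countable_lattice (hη.mul hφc).continuousOn
      (fun u hu => (hcl u hu.2).hasDerivAt.mul (hφ.hasDerivAt u)) (i2.add i1)
    rw [intervalIntegral.integral_add i2 i1, hper.apply_neg_pi, hφ.periodic.apply_neg_pi] at this
    rw [integral_torusMeasure, integral_torusMeasure]
    linarith
  refine ⟨⟨hη, hper, deriv η, hweak, hL2, fun φ hφ => ?_⟩, hweak⟩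
  have hφc := hφ.smooth.continuous
  rw [integral_torusMeasure]
  have i1 : IntervalIntegrable (fun u => (c ^ 2 - 2 * η u) * deriv η u * deriv φ u) volume
      (-Real.pi) Real.pi := (hq.mul hφ.continuous_deriv).intervalIntegrable _ _
  have i2 := hsq.mul_continuousOn hφc.continuousOn
  have i3 : IntervalIntegrable (fun u => η u * φ u) volume (-Real.pi) Real.pi :=
    (hη.mul hφc).intervalIntegrable _ _
  rw [integral_eq_of_hasDerivAt_off_countable_of_le (fun u => q u * φ u) _
    (by linarith : -Real.pi ≤ Real.pi) countable_lattice (hq.mul hφc).continuousOn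
    (fun u hu => ?_) ((i1.sub i2).sub i3)]
  · rw [hqper, hφ.periodic.apply_neg_pi, sub_self]
  · convert! (hcl u hu.2).hasDerivAt_flux.mul (hφ.hasDerivAt u) using 1
    ring

/-! ### The singular family -/

/-- The root `√(m - 2 + m sin² t)` in the clock of a singular wave. -/
noncomputable def cuspRoot (m t : ℝ) : ℝ := √(m - 2 + m * Real.sin t ^ 2)

/-- The density of the clock of the singular waves of speed `c`. -/
noncomputable def cuspDensity (c m t : ℝ) : ℝ := 2 * c * m * Real.sin t ^ 2 / cuspRoot m t

/-- The singular profile as a function of the clock angle. -/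
noncomputable def cuspProfile (c m t : ℝ) : ℝ := c ^ 2 / 2 - c ^ 2 * m / 2 * Real.sin t ^ 2

/-- The half period of the singular wave of unit speed. -/
noncomputable def cuspHalfPeriod (m : ℝ) : ℝ := ∫ t in (0 : ℝ)..Real.pi / 2, cuspDensity 1 m t

theorem cuspRoot_sq {m : ℝ} (hm : 2 ≤ m) (t : ℝ) :
    cuspRoot m t ^ 2 = m - 2 + m * Real.sin t ^ 2 :=
  Real.sq_sqrt (by nlinarith [sq_nonneg (Real.sin t)])

theorem cuspRoot_radicand_pos {m t : ℝ} (hm : 2 ≤ m) (ht : Real.sin t ≠ 0) :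
    0 < m - 2 + m * Real.sin t ^ 2 := by
  have := sq_pos_of_ne_zero ht
  nlinarith

theorem cuspRoot_pos {m t : ℝ} (hm : 2 ≤ m) (ht : Real.sin t ≠ 0) : 0 < cuspRoot m t :=
  Real.sqrt_pos.2 (cuspRoot_radicand_pos hm ht)

theorem continuous_cuspRoot (m : ℝ) : Continuous (cuspRoot m) := by
  unfold cuspRoot; fun_prop

theorem cuspRoot_two (t : ℝ) : cuspRoot 2 t = √2 * |Real.sin t| := by
  rw [cuspRoot, sub_self, zero_add, Real.sqrt_mul (by norm_num), Real.sqrt_sq_eq_abs]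

/-- At m = 2 the quotient is 0/0 where the sine vanishes. Its value 0 by convention is also its
limit, so the formula holds everywhere. -/
theorem cuspDensity_two (c t : ℝ) : cuspDensity c 2 t = 2 * √2 * c * |Real.sin t| := by
  have h2 : √2 * √2 = 2 := Real.mul_self_sqrt (by norm_num)
  rw [cuspDensity, cuspRoot_two, ← sq_abs]
  rcases eq_or_ne (|Real.sin t|) 0 with h | h
  · simp [h]
  · field_simp
    linear_combination (-c) * h2

theorem continuous_cuspDensity {m : ℝ} (c : ℝ) (hm : 2 ≤ m) : Continuous (cuspDensity c m) := by
  rcases hm.eq_or_lt with rfl | hm'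
  · have : cuspDensity c 2 = fun t => 2 * √2 * c * |Real.sin t| := funext (cuspDensity_two c)
    rw [this]
    fun_prop
  · refine Continuous.div (by fun_prop) (continuous_cuspRoot m) fun t => (Real.sqrt_pos.2 ?_).ne'
    nlinarith [sq_nonneg (Real.sin t)]

theorem cuspDensity_eq (c m t : ℝ) : cuspDensity c m t = c * cuspDensity 1 m t := by
  simp only [cuspDensity]; ring

theorem cuspDensity_pos {c m t : ℝ} (hc : 0 < c) (hm : 2 ≤ m) (ht : Real.sin t ≠ 0) :
    0 < cuspDensity c m t := by
  have := cuspRoot_pos hm ht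
  unfold cuspDensity
  positivity

theorem cuspDensity_nonneg {c m : ℝ} (hc : 0 ≤ c) (hm : 2 ≤ m) (t : ℝ) :
    0 ≤ cuspDensity c m t :=
  div_nonneg (by positivity) (Real.sqrt_nonneg _)

theorem isClock_cuspDensity {c m : ℝ} (hc : 0 < c) (hm : 2 ≤ m)
    (h : c * cuspHalfPeriod m = Real.pi) : IsClock (Real.pi / 2) (cuspDensity c m) where
  pos := by linarith [Real.pi_pos]
  continuous := continuous_cuspDensity c hm
  even t := by simp [cuspDensity, cuspRoot]
  periodic t := by
    rw [mul_div_cancel₀ _ two_ne_zero]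
    simp [cuspDensity, cuspRoot, Real.sin_add_pi]
  nonneg := cuspDensity_nonneg hc.le hm
  countable := by
    refine (countable_range fun n : ℤ => (n : ℝ) * Real.pi).mono fun t ht => ?_
    by_contra hn
    refine (cuspDensity_pos hc hm fun h0 => hn ?_).ne' ht
    exact Real.sin_eq_zero_iff.1 h0
  integral := by
    refine Eq.trans ?_ h
    rw [cuspHalfPeriod, ← intervalIntegral.integral_const_mul]
    exact intervalIntegral.integral_congr fun t _ => cuspDensity_eq c m t

theorem sin_phase_ne_zero {c m : ℝ} (hc : 0 < c) (hm : 2 ≤ m)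
    (h : c * cuspHalfPeriod m = Real.pi) {u : ℝ} (hu : u ∉ lattice) :
    Real.sin ((isClock_cuspDensity hc hm h).phase u) ≠ 0 := by
  intro h0
  obtain ⟨n, hn⟩ := Real.sin_eq_zero_iff.1 h0
  refine hu ?_
  have hC := isClock_cuspDensity hc hm h
  have h1 := hC.phase_int_mul n
  rw [mul_div_cancel₀ _ two_ne_zero, hn] at h1
  rw [← hC.strictMono_phase.injective h1]
  exact int_mul_mem_lattice n

theorem sin_phase_eq_zero {c m : ℝ} (hc : 0 < c) (hm : 2 ≤ m)
    (h : c * cuspHalfPeriod m = Real.pi) {u : ℝ} (hu : u ∈ lattice) :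
    Real.sin ((isClock_cuspDensity hc hm h).phase u) = 0 := by
  obtain ⟨k, rfl⟩ := hu
  have hC := isClock_cuspDensity hc hm h
  have h1 := hC.phase_int_mul k
  rw [mul_div_cancel₀ _ two_ne_zero] at h1
  rw [show 2 * Real.pi * (k : ℝ) = k * (2 * Real.pi) by ring, h1]
  exact Real.sin_int_mul_pi k

/-- The slope of the singular wave as a function of the clock angle. -/
noncomputable def cuspSlope (c m t : ℝ) : ℝ := -(c / 2) * (Real.cos t * cuspRoot m t) / Real.sin t

theorem hasDerivAt_cuspProfile {c m : ℝ} (hc : 0 < c) (hm : 2 ≤ m) {t : ℝ} (ht : Real.sin t ≠ 0) :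
    HasDerivAt (cuspProfile c m) (cuspSlope c m t * cuspDensity c m t) t := by
  have hR := (cuspRoot_pos hm ht).ne'
  convert! (((Real.hasDerivAt_sin t).pow 2).const_mul (c ^ 2 * m / 2)).const_sub (c ^ 2 / 2) using 1
  rw [cuspSlope, cuspDensity]
  field_simp
  norm_num
  left
  ring

theorem isClassicalSolutionAt_cusp {c m : ℝ} (hc : 0 < c) (hm : 2 ≤ m)
    (h : c * cuspHalfPeriod m = Real.pi) {u : ℝ} (hu : u ∉ lattice) :
    IsClassicalSolutionAt c
      (fun u => cuspProfile c m ((isClock_cuspDensity hc hm h).phase u)) u := by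
  have hC := isClock_cuspDensity hc hm h
  have hs := sin_phase_ne_zero hc hm h hu
  change IsClassicalSolutionAt c (fun u => cuspProfile c m (hC.phase u)) u
  change Real.sin (hC.phase u) ≠ 0 at hs
  set φ := hC.phase u
  have hR := (cuspRoot_pos hm hs).ne'
  have hrad := (cuspRoot_radicand_pos hm hs).ne'
  have hsq := cuspRoot_sq hm φ
  have hdR : HasDerivAt (cuspRoot m) (m * Real.sin φ * Real.cos φ / cuspRoot m φ) φ := by
    have h1 : HasDerivAt (fun t => m - 2 + m * Real.sin t ^ 2)
        (2 * m * Real.sin φ * Real.cos φ) φ := by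
      convert! (((Real.hasDerivAt_sin φ).pow 2).const_mul m).const_add (m - 2) using 1
      norm_num
      ring
    convert! h1.sqrt hrad using 1
    change _ = _ / (2 * cuspRoot m φ)
    field_simp
  have hdr : HasDerivAt (cuspSlope c m)
      ((-(c / 2) * (-Real.sin φ * cuspRoot m φ
        + Real.cos φ * (m * Real.sin φ * Real.cos φ / cuspRoot m φ)) * Real.sin φ
        - -(c / 2) * (Real.cos φ * cuspRoot m φ) * Real.cos φ) / Real.sin φ ^ 2) φ :=
    (((Real.hasDerivAt_cos φ).mul hdR).const_mul (-(c / 2))).div (Real.hasDerivAt_sin φ) hs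
  refine hC.isClassicalSolutionAt_comp (cuspDensity_pos hc hm hs).ne' ?_ ?_
    (fun t ht => hasDerivAt_cuspProfile hc hm fun h0 => ht (by simp [cuspDensity, h0])) hdr ?_
  · refine ContDiffAt.div (ContDiff.contDiffAt (by fun_prop)) ?_ hR
    exact ContDiffAt.sqrt (ContDiff.contDiffAt (by fun_prop)) hrad
  · unfold cuspProfile
    fun_prop
  · have hcs := Real.sin_sq_add_cos_sq φ
    change (c ^ 2 - 2 * cuspProfile c m φ) * (_ * (cuspDensity c m φ)⁻¹) - cuspSlope c m φ ^ 2
      + cuspProfile c m φ = 0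
    have hm0 : m ≠ 0 := by linarith
    rw [cuspProfile, cuspSlope, cuspDensity]
    set s := Real.sin φ
    set k := Real.cos φ
    set R := cuspRoot m φ
    field_simp
    have hk : k ^ 2 = 1 - s ^ 2 := by linarith
    have hR2 : R ^ 2 = m - 2 + m * s ^ 2 := hsq
    ring_nf
    ring_nf at hR2 hk
    simp only [hR2, hk]
    ring

theorem hasDerivAt_cusp {c m : ℝ} (hc : 0 < c) (hm : 2 ≤ m)
    (h : c * cuspHalfPeriod m = Real.pi) {u : ℝ} (hu : u ∉ lattice) :
    HasDerivAt (fun u => cuspProfile c m ((isClock_cuspDensity hc hm h).phase u))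
      (cuspSlope c m ((isClock_cuspDensity hc hm h).phase u)) u := by
  have hC := isClock_cuspDensity hc hm h
  have hs := sin_phase_ne_zero hc hm h hu
  have hp := (cuspDensity_pos hc hm hs).ne'
  have := (hasDerivAt_cuspProfile hc hm hs).comp u
    ((isClock_cuspDensity hc hm h).hasDerivAt_phase hp)
  rwa [mul_assoc, mul_inv_cancel₀ hp, mul_one] at this

theorem isContinuousWave_cusp {c m : ℝ} (hc : 0 < c) (hm : 2 ≤ m)
    (h : c * cuspHalfPeriod m = Real.pi) :
    IsContinuousWave c (fun u => cuspProfile c m ((isClock_cuspDensity hc hm h).phase u)) ∧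
    HasWeakDeriv (fun u => cuspProfile c m ((isClock_cuspDensity hc hm h).phase u))
      (deriv fun u => cuspProfile c m ((isClock_cuspDensity hc hm h).phase u)) := by
  have hC := isClock_cuspDensity hc hm h
  set η := fun u => cuspProfile c m (hC.phase u) with hη
  have hlobe : IsSingleLobe η := by
    refine hC.isSingleLobe_comp (fun t => by simp [cuspProfile]) (fun t => ?_) fun x hx y hy hxy => ?_
    · rw [mul_div_cancel₀ _ two_ne_zero]
      simp [cuspProfile, Real.sin_add_pi]
    · have h1 : Real.sin x < Real.sin y := Real.sin_lt_sin_of_lt_of_le_pi_div_two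
        (by linarith [hx.1, Real.pi_pos]) hy.2 hxy
      have h2 : 0 ≤ Real.sin x :=
        Real.sin_nonneg_of_nonneg_of_le_pi hx.1 (by linarith [hx.2, Real.pi_pos])
      have h3 : 0 < c ^ 2 * m / 2 := by positivity
      have h4 : Real.sin x ^ 2 < Real.sin y ^ 2 := by nlinarith
      simp only [cuspProfile]
      nlinarith
  have hcont : Continuous η := by
    have := hC.continuous_phase
    simp only [hη, cuspProfile]
    fun_prop
  have hflux : (fun u => (c ^ 2 - 2 * η u) * deriv η u) = fun u => -(c ^ 3 * m / 2) *
      (Real.sin (hC.phase u) * Real.cos (hC.phase u) * cuspRoot m (hC.phase u)) := by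
    funext u
    -- At a crest the factor c² − 2η vanishes, so the value of `deriv η` there is irrelevant.
    by_cases hu : u ∈ lattice
    · have hs : Real.sin (hC.phase u) = 0 := sin_phase_eq_zero hc hm h hu
      simp [hη, cuspProfile, hs]
      left
      ring
    · have hs : Real.sin (hC.phase u) ≠ 0 := sin_phase_ne_zero hc hm h hu
      rw [show deriv η u = _ from (hasDerivAt_cusp hc hm h hu).deriv]
      simp only [hη, cuspProfile, cuspSlope]
      field_simp
      ring
  have hw := weak_of_classical hcont hlobe.periodic (c := c) (by
    rw [hflux]
    have := hC.continuous_phase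
    have := continuous_cuspRoot m
    fun_prop) fun u hu => isClassicalSolutionAt_cusp hc hm h hu
  exact ⟨⟨hlobe, hw.1⟩, hw.2⟩

/-! ### The half period of the singular family -/

theorem cuspHalfPeriod_two : cuspHalfPeriod 2 = 2 * √2 := by
  have h : ∀ t ∈ uIcc 0 (Real.pi / 2), cuspDensity 1 2 t = 2 * √2 * Real.sin t := by
    intro t ht
    rw [uIcc_of_le (by linarith [Real.pi_pos])] at ht
    rw [cuspDensity_two, abs_of_nonneg, mul_one]
    exact Real.sin_nonneg_of_nonneg_of_le_pi ht.1 (by linarith [ht.2, Real.pi_pos])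
  rw [cuspHalfPeriod, intervalIntegral.integral_congr h, intervalIntegral.integral_const_mul]
  simp

/-- The integrand is not jointly continuous at (m, t) = (2, 0), so continuity is by domination: sin²
t ≤ `cuspRoot` and m ≤ 3 bound it by 6. -/
theorem continuousOn_cuspHalfPeriod : ContinuousOn cuspHalfPeriod (Icc 2 3) := by
  intro m hm
  have hmem : ∀ᶠ x in 𝓝[Icc 2 3] m, x ∈ Icc (2 : ℝ) 3 := self_mem_nhdsWithin
  refine intervalIntegral.continuousWithinAt_of_dominated_interval (bound := fun _ => 6) ?_ ?_
    intervalIntegrable_const ?_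
  · filter_upwards [hmem] with x hx
    exact (continuous_cuspDensity 1 hx.1).aestronglyMeasurable
  · filter_upwards [hmem] with x hx
    refine Eventually.of_forall fun t _ => ?_
    rw [Real.norm_of_nonneg (cuspDensity_nonneg zero_le_one hx.1 t)]
    have hR : Real.sin t ^ 2 ≤ cuspRoot x t := by
      refine Real.le_sqrt_of_sq_le ?_
      nlinarith [sq_nonneg (Real.sin t), Real.sin_sq_le_one t, hx.1]
    refine div_le_of_le_mul₀ (Real.sqrt_nonneg _) (by norm_num) ?_
    change _ ≤ 6 * cuspRoot x t
    nlinarith [sq_nonneg (Real.sin t), hx.2]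
  · refine Eventually.of_forall fun t ht => ContinuousAt.continuousWithinAt ?_
    rw [uIoc_of_le (by linarith [Real.pi_pos])] at ht
    have hs : Real.sin t ≠ 0 :=
      (Real.sin_pos_of_pos_of_lt_pi ht.1 (by linarith [ht.2, Real.pi_pos])).ne'
    refine ContinuousAt.div (by fun_prop) ?_ (cuspRoot_pos hm.1 hs).ne'
    unfold cuspRoot
    fun_prop

/-- With ρ = √(κ + s²) one has κ = (ρ − s)(ρ + s) ≤ 2ρ(ρ − s). The weaker bound with the factor k,
later cos t, makes the correction a logarithmic derivative in t. -/
theorem sq_div_sqrt_le {κ s k : ℝ} (hκ : 0 < κ) (hs : 0 ≤ s) (hk : k ≤ 1) :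
    s ^ 2 / √(κ + s ^ 2) ≤ s - κ / 4 * (2 * s * k / (κ + s ^ 2)) := by
  have hpos : 0 < κ + s ^ 2 := by positivity
  have hsq := Real.sq_sqrt hpos.le
  set ρ := √(κ + s ^ 2)
  have hρ : 0 < ρ := Real.sqrt_pos.2 hpos
  have hle : s ≤ ρ := Real.le_sqrt_of_sq_le (by linarith)
  rw [← hsq, ← sub_nonneg]
  have : s - κ / 4 * (2 * s * k / ρ ^ 2) - s ^ 2 / ρ
      = s * (2 * ρ * (ρ - s) - κ * k) / (2 * ρ ^ 2) := by
    field_simp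
    ring
  rw [this]
  refine div_nonneg (mul_nonneg hs ?_) (by positivity)
  nlinarith [mul_nonneg (sub_nonneg.2 hle) (sub_nonneg.2 hle)]

theorem integral_sin_sub_log {κ : ℝ} (hκ : 0 < κ) :
    ∫ t in (0 : ℝ)..Real.pi / 2,
      (Real.sin t - κ / 4 * (2 * Real.sin t * Real.cos t / (κ + Real.sin t ^ 2))) =
      1 - κ / 4 * (Real.log (κ + 1) - Real.log κ) := by
  have hpos : ∀ t, κ + Real.sin t ^ 2 ≠ 0 := fun t => by positivity
  rw [intervalIntegral.integral_eq_sub_of_hasDerivAt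
    (f := fun t => -Real.cos t - κ / 4 * Real.log (κ + Real.sin t ^ 2))]
  · simp
    ring
  · intro t _
    have h1 : HasDerivAt (fun t => κ + Real.sin t ^ 2) (2 * Real.sin t * Real.cos t) t := by
      convert! ((Real.hasDerivAt_sin t).pow 2).const_add κ using 1
      norm_num
    convert! (Real.hasDerivAt_cos t).neg.sub ((h1.log (hpos t)).const_mul (κ / 4)) using 1
    ring
  · refine Continuous.intervalIntegrable ?_ _ _
    refine Real.continuous_sin.sub (continuous_const.mul (Continuous.div ?_ ?_ hpos)) <;> fun_prop

theorem exists_cuspHalfPeriod_lt : ∃ m ∈ Ioc (2 : ℝ) 3, cuspHalfPeriod m < 2 * √2 := by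
  -- Here κ = (m − 2)/m = 1/81, and log 82 > 4 because e⁴ < 3⁴ = 81. The half period is then below
  -- 2√m (1 − κ) = 2√m · 80/81, and m (80/81)² = 160/81 < 2.
  refine ⟨81 / 40, by norm_num, ?_⟩
  have hμ : √(81 / 40 : ℝ) ^ 2 = 81 / 40 := Real.sq_sqrt (by norm_num)
  set μ := √(81 / 40 : ℝ)
  have hμ0 : 0 < μ := Real.sqrt_pos.2 (by norm_num)
  have hroot : ∀ t, cuspRoot (81 / 40) t = μ * √(1 / 81 + Real.sin t ^ 2) := by
    intro t
    rw [cuspRoot, ← Real.sqrt_mul (by norm_num)]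
    congr 1
    ring
  have hle : cuspHalfPeriod (81 / 40) ≤ ∫ t in (0 : ℝ)..Real.pi / 2, 2 * μ * (Real.sin t -
      1 / 81 / 4 * (2 * Real.sin t * Real.cos t / (1 / 81 + Real.sin t ^ 2))) := by
    refine intervalIntegral.integral_mono_on (by linarith [Real.pi_pos])
      ((continuous_cuspDensity 1 (by norm_num)).intervalIntegrable _ _)
      (Continuous.intervalIntegrable ?_ _ _) fun t ht => ?_
    · refine continuous_const.mul (Real.continuous_sin.sub
        (continuous_const.mul (Continuous.div ?_ ?_ fun t => ?_)))
      · fun_prop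
      · fun_prop
      · positivity
    · have hs : 0 ≤ Real.sin t :=
        Real.sin_nonneg_of_nonneg_of_le_pi ht.1 (by linarith [ht.2, Real.pi_pos])
      have := sq_div_sqrt_le (κ := 1 / 81) (by norm_num) hs (Real.cos_le_one t)
      refine le_trans (le_of_eq ?_) (mul_le_mul_of_nonneg_left this (by positivity : 0 ≤ 2 * μ))
      have h0 : √(1 / 81 + Real.sin t ^ 2) ≠ 0 := (Real.sqrt_pos.2 (by positivity)).ne'
      rw [cuspDensity, hroot]
      field_simp
      rw [hμ]
      ring
  rw [intervalIntegral.integral_const_mul, integral_sin_sub_log (by norm_num),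
    ← Real.log_div (by norm_num) (by norm_num)] at hle
  have hlog : 4 < Real.log ((1 / 81 + 1) / (1 / 81)) := by
    rw [Real.lt_log_iff_exp_lt (by norm_num)]
    have h3 : Real.exp 1 < 3 := Real.exp_one_lt_three
    have : Real.exp 4 = Real.exp 1 ^ 4 := by rw [← Real.exp_nat_mul]; norm_num
    rw [this]
    have h0 := Real.exp_pos 1
    calc Real.exp 1 ^ 4 < 3 ^ 4 := by gcongr
      _ < _ := by norm_num
  refine hle.trans_lt ?_
  have h1 : μ * (80 / 81) < √2 := Real.lt_sqrt_of_sq_lt (by rw [mul_pow, hμ]; norm_num)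
  nlinarith

theorem cuspHalfPeriod_pos {m : ℝ} (hm : 2 ≤ m) : 0 < cuspHalfPeriod m := by
  have hpi := Real.pi_pos
  refine intervalIntegral.integral_pos (by linarith) (continuous_cuspDensity 1 hm).continuousOn
    (fun t _ => cuspDensity_nonneg zero_le_one hm t)
    ⟨Real.pi / 2, ⟨by linarith, le_rfl⟩, cuspDensity_pos zero_lt_one hm (by simp)⟩

theorem exists_cuspHalfPeriod_eq :
    ∃ cInf : ℝ, cStar < cInf ∧ ∀ c ∈ Ioo cStar cInf,
      ∃ m, 2 < m ∧ c * cuspHalfPeriod m = Real.pi := by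
  obtain ⟨m₀, hm₀, hlt⟩ := exists_cuspHalfPeriod_lt
  have hpos := cuspHalfPeriod_pos hm₀.1.le
  have hstar := two_sqrt_two_mul_cStar
  have hs0 : 0 < cStar := zero_lt_one.trans one_lt_cStar
  -- This is the speed of the wave with parameter m₀; the speeds between it and c_* are attained for
  -- m between 2 and m₀.
  refine ⟨Real.pi / cuspHalfPeriod m₀, ?_, fun c hc => ?_⟩
  · rw [lt_div_iff₀ hpos]
    nlinarith
  · have hc0 : 0 < c := hs0.trans hc.1
    have hcont : ContinuousOn (fun m => c * cuspHalfPeriod m) (Icc 2 m₀) :=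
      continuousOn_const.mul (continuousOn_cuspHalfPeriod.mono (Icc_subset_Icc_right hm₀.2))
    obtain ⟨m, hm, h⟩ := intermediate_value_Ioo' hm₀.1.le hcont (show Real.pi ∈ _ from by
      refine ⟨(lt_div_iff₀ hpos).1 hc.2, ?_⟩
      rw [cuspHalfPeriod_two, ← hstar, mul_comm]
      exact mul_lt_mul_of_pos_right hc.1 (by positivity))
    exact ⟨m, hm.1, h⟩

/-! ### Behaviour of the singular waves at the crest -/

theorem cuspDensity_le {c m : ℝ} (hc : 0 < c) (hm : 2 < m) (t : ℝ) :
    cuspDensity c m t ≤ 2 * c * m / √(m - 2) * t ^ 2 := by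
  have hn : 0 < √(m - 2) := Real.sqrt_pos.2 (by linarith)
  have h1 : √(m - 2) ≤ cuspRoot m t := Real.sqrt_le_sqrt (by nlinarith [sq_nonneg (Real.sin t)])
  have h2 : Real.sin t ^ 2 ≤ t ^ 2 := sq_le_sq.2 Real.abs_sin_le_abs
  rw [cuspDensity, div_mul_eq_mul_div]
  gcongr

theorem sq_sub_le_sin_sq {t : ℝ} (h0 : 0 ≤ t) (h1 : t ≤ 1) :
    t ^ 2 - t ^ 4 / 2 ≤ Real.sin t ^ 2 := by
  rcases h0.eq_or_lt with rfl | h0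
  · simp
  have h := Real.sin_gt_sub_cube h0
  have h2 : 0 ≤ t - t ^ 3 / 6 := by nlinarith [mul_pos h0 h0, pow_le_one₀ h0.le h1 (n := 2)]
  have h3 : (t - t ^ 3 / 6) ^ 2 ≤ Real.sin t ^ 2 := by
    gcongr
  nlinarith [pow_pos h0 6]

/-- With x = m t²/(2(m − 2)) the root is at most √(m − 2)(1 + x), and 1/(1 + x) ≥ 1 − x. The
quadratic relative error is what yields the exponent 4/3 in the crest expansion. -/
theorem le_cuspDensity {c m t : ℝ} (hc : 0 < c) (hm : 2 < m) (h0 : 0 ≤ t) (h1 : t ≤ 1) :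
    2 * c * m / √(m - 2) * (t ^ 2 - (1 / 2 + m / (2 * (m - 2))) * t ^ 4) ≤ cuspDensity c m t := by
  have hm2 : 0 < m - 2 := by linarith
  have hm0 : 0 < m := by linarith
  have hn : 0 < √(m - 2) := Real.sqrt_pos.2 hm2
  have hsq := Real.sq_sqrt hm2.le
  set n := √(m - 2)
  have h2 : Real.sin t ^ 2 ≤ t ^ 2 := sq_le_sq.2 Real.abs_sin_le_abs
  set x := m / (2 * (m - 2)) * t ^ 2 with hx
  have hx0 : 0 ≤ x := by positivity
  have hR : cuspRoot m t ≤ n * (1 + x) := by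
    refine Real.sqrt_le_iff.2 ⟨by positivity, ?_⟩
    have : (m - 2) * (2 * x) = m * t ^ 2 := by rw [hx]; field_simp
    rw [mul_pow, hsq]
    nlinarith [mul_nonneg hm2.le (sq_nonneg x)]
  have hRpos : 0 < cuspRoot m t := Real.sqrt_pos.2 (by positivity)
  have h3 := sq_sub_le_sin_sq h0 h1
  rw [cuspDensity, le_div_iff₀ hRpos]
  have h4 : t ^ 2 - (1 / 2 + m / (2 * (m - 2))) * t ^ 4 ≤ (t ^ 2 - t ^ 4 / 2) * (1 - x) := by
    have : 0 ≤ t ^ 4 / 2 * x := by positivity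
    rw [hx] at this ⊢
    nlinarith
  rcases le_total (t ^ 2 - (1 / 2 + m / (2 * (m - 2))) * t ^ 4) 0 with h5 | h5
  · exact (mul_nonpos_of_nonpos_of_nonneg (mul_nonpos_of_nonneg_of_nonpos (by positivity) h5)
      hRpos.le).trans (by positivity)
  · have h6 : 0 ≤ t ^ 2 - t ^ 4 / 2 := by
      nlinarith [pow_le_one₀ h0 h1 (n := 2), sq_nonneg t]
    calc 2 * c * m / n * (t ^ 2 - (1 / 2 + m / (2 * (m - 2))) * t ^ 4) * cuspRoot m t
        ≤ 2 * c * m / n * ((t ^ 2 - t ^ 4 / 2) * (1 - x)) * (n * (1 + x)) := by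
          have := mul_le_mul_of_nonneg_left h4 (by positivity : 0 ≤ 2 * c * m / n)
          exact mul_le_mul this hR hRpos.le (le_trans (by positivity) this)
      _ = 2 * c * m * ((t ^ 2 - t ^ 4 / 2) * (1 - x ^ 2)) := by
          field_simp
          ring
      _ ≤ 2 * c * m * Real.sin t ^ 2 := by
          gcongr
          nlinarith [mul_nonneg h6 (sq_nonneg x)]

theorem time_cuspDensity_le {c m φ : ℝ} (hc : 0 < c) (hm : 2 < m) (h0 : 0 ≤ φ) :
    time (cuspDensity c m) φ ≤ 2 * c * m / √(m - 2) / 3 * φ ^ 3 := by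
  have : ∫ t in (0 : ℝ)..φ, 2 * c * m / √(m - 2) * t ^ 2 = 2 * c * m / √(m - 2) / 3 * φ ^ 3 := by
    rw [intervalIntegral.integral_const_mul, integral_pow]
    norm_num
    ring
  rw [← this]
  exact intervalIntegral.integral_mono_on h0
    ((continuous_cuspDensity c hm.le).intervalIntegrable _ _)
    (Continuous.intervalIntegrable (by fun_prop) _ _) fun t _ => cuspDensity_le hc hm t

theorem le_time_cuspDensity {c m φ : ℝ} (hc : 0 < c) (hm : 2 < m) (h0 : 0 ≤ φ) (h1 : φ ≤ 1) :
    2 * c * m / √(m - 2) / 3 * φ ^ 3 * (1 - (1 / 2 + m / (2 * (m - 2))) * φ ^ 2) ≤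
      time (cuspDensity c m) φ := by
  set C := 1 / 2 + m / (2 * (m - 2))
  have hm2 : 0 < m - 2 := by linarith
  have hC : 0 ≤ C := by positivity
  have hK : 0 ≤ 2 * c * m / √(m - 2) := by positivity
  set K := 2 * c * m / √(m - 2)
  have : ∫ t in (0 : ℝ)..φ, K * (t ^ 2 - C * t ^ 4) = K * (φ ^ 3 / 3 - C * (φ ^ 5 / 5)) := by
    rw [intervalIntegral.integral_const_mul, intervalIntegral.integral_sub
      (Continuous.intervalIntegrable (by fun_prop) _ _)
      (Continuous.intervalIntegrable (by fun_prop) _ _), intervalIntegral.integral_const_mul,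
      integral_pow, integral_pow]
    norm_num
  have hmono : ∫ t in (0 : ℝ)..φ, K * (t ^ 2 - C * t ^ 4) ≤ time (cuspDensity c m) φ :=
    intervalIntegral.integral_mono_on h0 (Continuous.intervalIntegrable (by fun_prop) _ _)
      ((continuous_cuspDensity c hm.le).intervalIntegrable _ _)
      fun t ht => le_cuspDensity hc hm ht.1 (ht.2.trans h1)
  rw [this] at hmono
  refine le_trans ?_ hmono
  have : 0 ≤ K * (C * φ ^ 5) := by positivity
  nlinarith

/-- The ratio x = u/(Kφ³) lies in [1 − Cφ², 1], hence in [1/2, 1]. Then u^(2/3) is K^(2/3)φ² up to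
O(φ⁴), sin² φ is φ² up to O(φ⁴), and φ⁴ is at most a constant times u^(4/3). -/
theorem abs_cuspProfile_sub_le {c m φ u K C : ℝ} (hm : 2 ≤ m) (hK : 0 < K) (hC : 0 ≤ C)
    (h0 : 0 < φ) (h1 : φ ≤ 1) (hCφ : C * φ ^ 2 ≤ 1 / 2) (hu : u ≤ K * φ ^ 3)
    (hu' : K * φ ^ 3 * (1 - C * φ ^ 2) ≤ u) :
    |cuspProfile c m φ - (c ^ 2 / 2 - c ^ 2 * m / 2 / K ^ (2 / 3 : ℝ) * u ^ (2 / 3 : ℝ))| ≤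
      c ^ 2 * m / 2 * ((C + 1 / 2) * 4) / K ^ (4 / 3 : ℝ) * u ^ (4 / 3 : ℝ) := by
  have hφ3 : 0 < φ ^ 3 := by positivity
  set x := u / (K * φ ^ 3) with hx
  have hux : u = K * φ ^ 3 * x := by rw [hx]; field_simp
  have hx1 : x ≤ 1 := by rw [hx, div_le_one (by positivity)]; exact hu
  have hxC : 1 - C * φ ^ 2 ≤ x := by rw [hx, le_div_iff₀ (by positivity)]; linarith
  have hx0 : 0 < x := by linarith
  have e23 : u ^ (2 / 3 : ℝ) = K ^ (2 / 3 : ℝ) * φ ^ 2 * x ^ (2 / 3 : ℝ) := by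
    rw [hux, Real.mul_rpow (by positivity) hx0.le, Real.mul_rpow hK.le hφ3.le,
      ← Real.rpow_natCast φ 3, ← Real.rpow_mul h0.le, ← Real.rpow_natCast φ 2]
    norm_num
  have e43 : u ^ (4 / 3 : ℝ) = K ^ (4 / 3 : ℝ) * φ ^ 4 * x ^ (4 / 3 : ℝ) := by
    rw [hux, Real.mul_rpow (by positivity) hx0.le, Real.mul_rpow hK.le hφ3.le,
      ← Real.rpow_natCast φ 3, ← Real.rpow_mul h0.le, ← Real.rpow_natCast φ 4]
    norm_num
  have hx23 : x ≤ x ^ (2 / 3 : ℝ) := by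
    simpa using Real.rpow_le_rpow_of_exponent_ge hx0 hx1 (by norm_num : (2 / 3 : ℝ) ≤ 1)
  have hx23' : x ^ (2 / 3 : ℝ) ≤ 1 := Real.rpow_le_one hx0.le hx1 (by norm_num)
  -- Since x ≤ 1, x^(4/3) ≥ x² ≥ 1/4.
  have hx43 : 1 / 4 ≤ x ^ (4 / 3 : ℝ) := by
    have h2 := Real.rpow_le_rpow_of_exponent_ge hx0 hx1 (by norm_num : (4 / 3 : ℝ) ≤ (2 : ℕ))
    rw [Real.rpow_natCast] at h2
    nlinarith
  have hs1 := sq_sub_le_sin_sq h0.le h1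
  have hs2 : Real.sin φ ^ 2 ≤ φ ^ 2 := sq_le_sq.2 Real.abs_sin_le_abs
  have hK1 : K ^ (2 / 3 : ℝ) ≠ 0 := (Real.rpow_pos_of_pos hK _).ne'
  have hK2 : K ^ (4 / 3 : ℝ) ≠ 0 := (Real.rpow_pos_of_pos hK _).ne'
  have lhs : cuspProfile c m φ - (c ^ 2 / 2 - c ^ 2 * m / 2 / K ^ (2 / 3 : ℝ) * u ^ (2 / 3 : ℝ))
      = c ^ 2 * m / 2 * (φ ^ 2 * x ^ (2 / 3 : ℝ) - Real.sin φ ^ 2) := by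
    rw [e23, cuspProfile]
    field_simp
    ring
  have rhs : c ^ 2 * m / 2 * ((C + 1 / 2) * 4) / K ^ (4 / 3 : ℝ) * u ^ (4 / 3 : ℝ)
      = c ^ 2 * m / 2 * ((C + 1 / 2) * 4 * φ ^ 4 * x ^ (4 / 3 : ℝ)) := by
    rw [e43]
    field_simp
  have hcm : 0 ≤ c ^ 2 * m / 2 := by positivity
  rw [lhs, rhs, abs_mul, abs_of_nonneg hcm]
  refine mul_le_mul_of_nonneg_left ?_ hcm
  have hφ2 : 0 < φ ^ 2 := by positivity
  have hφ4 : φ ^ 4 = φ ^ 2 * φ ^ 2 := by ring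
  have h3 : (C + 1 / 2) * φ ^ 4 ≤ (C + 1 / 2) * 4 * φ ^ 4 * x ^ (4 / 3 : ℝ) := by
    have : 0 ≤ (C + 1 / 2) * φ ^ 4 := by positivity
    nlinarith
  refine le_trans ?_ h3
  have h4 : φ ^ 2 * (1 - C * φ ^ 2) ≤ φ ^ 2 * x ^ (2 / 3 : ℝ) := by
    gcongr
    exact hxC.trans hx23
  have h5 : φ ^ 2 * x ^ (2 / 3 : ℝ) ≤ φ ^ 2 * 1 := by gcongr
  have h6 : 0 ≤ C * φ ^ 4 := by positivity
  rw [abs_le]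
  constructor <;> nlinarith [sq_nonneg (φ ^ 2)]

theorem cusp_isBigO {c m : ℝ} (hc : 0 < c) (hm : 2 < m) (h : c * cuspHalfPeriod m = Real.pi) :
    ∃ A : ℝ, 0 < A ∧
      (fun u : ℝ => cuspProfile c m ((isClock_cuspDensity hc hm.le h).phase u) -
        (c ^ 2 / 2 - A * |u| ^ (2 / 3 : ℝ))) =O[𝓝 0] fun u : ℝ => |u| ^ (4 / 3 : ℝ) := by
  have hC := isClock_cuspDensity hc hm.le h
  have hm2 : 0 < m - 2 := by linarith
  have hm0 : 0 < m := by linarith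
  have hn : 0 < √(m - 2) := Real.sqrt_pos.2 hm2
  set K := 2 * c * m / √(m - 2) / 3
  set C := 1 / 2 + m / (2 * (m - 2))
  have hK : 0 < K := by positivity
  have hC0 : 0 ≤ C := by positivity
  refine ⟨c ^ 2 * m / 2 / K ^ (2 / 3 : ℝ), by positivity, Asymptotics.IsBigO.of_bound
    (c ^ 2 * m / 2 * ((C + 1 / 2) * 4) / K ^ (4 / 3 : ℝ)) ?_⟩
  have hcont : Continuous fun u => hC.phase |u| := hC.continuous_phase.comp continuous_abs
  have hz : hC.phase |0| = 0 := by rw [abs_zero, hC.phase_zero]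
  have ev1 : ∀ᶠ u in 𝓝 (0 : ℝ), hC.phase |u| < 1 :=
    hcont.continuousAt.eventually_lt_const (hz.trans_lt one_pos)
  have ev2 : ∀ᶠ u in 𝓝 (0 : ℝ), C * hC.phase |u| ^ 2 < 1 / 2 :=
    (by fun_prop : Continuous fun u => C * hC.phase |u| ^ 2).continuousAt.eventually_lt_const
      (by simp [hC.phase_zero])
  filter_upwards [ev1, ev2] with u h1 h2
  change ‖cuspProfile c m (hC.phase u) - _‖ ≤ _
  have heven : cuspProfile c m (hC.phase u) = cuspProfile c m (hC.phase |u|) := by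
    rcases abs_choice u with h | h
    · rw [h]
    · rw [h, hC.phase_neg]; simp [cuspProfile]
  rw [heven, Real.norm_eq_abs, Real.norm_of_nonneg (by positivity)]
  rcases eq_or_ne u 0 with rfl | hu
  · simp [hC.phase_zero, cuspProfile]
  have hpos : 0 < hC.phase |u| := by
    rw [← hC.phase_zero]
    exact hC.strictMono_phase (abs_pos.2 hu)
  refine abs_cuspProfile_sub_le hm.le hK hC0 hpos h1.le h2.le ?_ ?_
  · have := time_cuspDensity_le hc hm hpos.le
    rwa [hC.time_phase] at this
  · have := le_time_cuspDensity hc hm hpos.le h1.le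
    rwa [hC.time_phase] at this

/-! ### The limiting wave -/

theorem cStar_pos : 0 < cStar := zero_lt_one.trans one_lt_cStar

theorem cStar_mul_cuspHalfPeriod_two : cStar * cuspHalfPeriod 2 = Real.pi := by
  rw [cuspHalfPeriod_two, mul_comm, two_sqrt_two_mul_cStar]

theorem cStar_sq : cStar ^ 2 = Real.pi ^ 2 / 8 := by
  rw [cStar, div_pow, mul_pow, Real.sq_sqrt (by norm_num)]
  norm_num

/-- The wave of speed `cStar` with a corner. -/
noncomputable def cornerWave (u : ℝ) : ℝ := cuspProfile cStar 2
  ((isClock_cuspDensity cStar_pos le_rfl cStar_mul_cuspHalfPeriod_two).phase u)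

theorem isContinuousWave_cornerWave : IsContinuousWave cStar cornerWave :=
  (isContinuousWave_cusp cStar_pos le_rfl cStar_mul_cuspHalfPeriod_two).1

/-- For m = 2 and c = c_* the clock is π sin t on the half period, so u = π(1 − cos φ) and the
profile is quadratic in u. -/
theorem cornerWave_eq {u : ℝ} (hu : u ∈ Icc 0 Real.pi) :
    cornerWave u = (Real.pi ^ 2 - 4 * Real.pi * u + 2 * u ^ 2) / 16 := by
  have hC := isClock_cuspDensity cStar_pos le_rfl cStar_mul_cuspHalfPeriod_two
  have hφ := hC.phase_mem_Icc hu
  have hpi := Real.pi_pos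
  have ht : u = Real.pi * (1 - Real.cos (hC.phase u)) := by
    have h : ∀ t ∈ uIcc 0 (hC.phase u), cuspDensity cStar 2 t = Real.pi * Real.sin t := by
      intro t ht
      rw [uIcc_of_le hφ.1] at ht
      rw [cuspDensity_two, abs_of_nonneg, two_sqrt_two_mul_cStar]
      exact Real.sin_nonneg_of_nonneg_of_le_pi ht.1 (by linarith [ht.2, hφ.2])
    have h2 := hC.time_phase u
    rw [time, intervalIntegral.integral_congr h, intervalIntegral.integral_const_mul,
      integral_sin, Real.cos_zero] at h2
    exact h2.symm
  have hcs := Real.sin_sq_add_cos_sq (hC.phase u)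
  change cuspProfile cStar 2 (hC.phase u) = _
  rw [cuspProfile, cStar_sq]
  generalize hC.phase u = φ at ht hcs ⊢
  rw [ht]
  linear_combination (-Real.pi ^ 2 / 8) * hcs

theorem cornerWave_eq_abs {u : ℝ} (hu : u ∈ Icc (-Real.pi) Real.pi) :
    cornerWave u = (Real.pi ^ 2 - 4 * Real.pi * |u| + 2 * u ^ 2) / 16 := by
  rw [← sq_abs u, ← cornerWave_eq ⟨abs_nonneg u, abs_le.2 hu⟩]
  rcases abs_choice u with h | h
  · rw [h]
  · rw [h, isContinuousWave_cornerWave.1.even]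

theorem ae_notMem_lattice : ∀ᵐ u ∂torusMeasure, u ∉ lattice :=
  ae_restrict_of_ae (countable_lattice.ae_notMem _)

theorem memW1Infty_cornerWave : MemW1Infty cornerWave := by
  have hC := isClock_cuspDensity cStar_pos le_rfl cStar_mul_cuspHalfPeriod_two
  have hc := cStar_pos
  have hcont := isContinuousWave_cornerWave.2.1
  refine ⟨memLp_top_of_bound hcont.aestronglyMeasurable (cStar ^ 2)
    (Eventually.of_forall fun u => ?_),
    deriv cornerWave, (isContinuousWave_cusp cStar_pos le_rfl cStar_mul_cuspHalfPeriod_two).2,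
    memLp_top_of_bound (measurable_deriv _).aestronglyMeasurable cStar ?_⟩
  · change |cuspProfile cStar 2 (hC.phase u)| ≤ _
    rw [cuspProfile, abs_le]
    constructor <;> nlinarith [sq_nonneg (Real.sin (hC.phase u)), Real.sin_sq_le_one (hC.phase u)]
  · filter_upwards [ae_notMem_lattice] with u hu
    have hd : deriv cornerWave u = cuspSlope cStar 2 (hC.phase u) :=
      (hasDerivAt_cusp cStar_pos le_rfl cStar_mul_cuspHalfPeriod_two hu).deriv
    have hs := abs_pos.2 (sin_phase_ne_zero cStar_pos le_rfl cStar_mul_cuspHalfPeriod_two hu)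
    change 0 < |Real.sin (hC.phase u)| at hs
    rw [hd, cuspSlope, cuspRoot_two, Real.norm_eq_abs, abs_div, div_le_iff₀ hs, abs_mul, abs_neg,
      abs_mul, abs_mul, abs_abs, abs_of_pos (by positivity : 0 < cStar / 2),
      abs_of_pos (by positivity : 0 < √2)]
    have h1 := Real.abs_cos_le_one (hC.phase u)
    have h2 : √2 ≤ 2 := by rw [Real.sqrt_le_left (by norm_num)]; norm_num
    calc cStar / 2 * (|Real.cos (hC.phase u)| * (√2 * |Real.sin (hC.phase u)|))
        ≤ cStar / 2 * (1 * (2 * |Real.sin (hC.phase u)|)) := by gcongr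
      _ = cStar * |Real.sin (hC.phase u)| := by ring

/-! ### Rigidity of profiles -/

theorem eq_left_of_hasDerivAt_zero {f f' : ℝ → ℝ} {a b : ℝ} (hc : ContinuousOn f (Icc a b))
    (hd : ∀ x ∈ Ioo a b, HasDerivAt f (f' x) x) (h0 : ∀ x ∈ Ioo a b, f' x = 0) :
    ∀ x ∈ Icc a b, f x = f a := by
  intro x hx
  rcases hx.1.eq_or_lt with rfl | hax
  · rfl
  obtain ⟨y, hy, h⟩ := exists_hasDerivAt_eq_slope f f' hax (hc.mono (Icc_subset_Icc_right hx.2))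
    fun y hy => hd y ⟨hy.1, hy.2.trans_le hx.2⟩
  rw [h0 y ⟨hy.1, hy.2.trans_le hx.2⟩, eq_comm, div_eq_zero_iff] at h
  rcases h with h | h <;> linarith

/-- The equation as a first order system for the profile `ζ` and the flux `Q = (c² - 2ζ) ζ'`, on the
part of the half period where it is not degenerate. -/
structure IsFluxSystem (c : ℝ) (ζ Q : ℝ → ℝ) : Prop where
  continuous : Continuous ζ
  continuous_flux : ContinuousOn Q (Icc 0 Real.pi)
  strictAntiOn : StrictAntiOn ζ (Icc 0 Real.pi)
  hasDerivAt : ∀ u ∈ Ioo 0 Real.pi, c ^ 2 - 2 * ζ u ≠ 0 →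
    HasDerivAt ζ (Q u / (c ^ 2 - 2 * ζ u)) u
  hasDerivAt_flux : ∀ u ∈ Ioo 0 Real.pi, c ^ 2 - 2 * ζ u ≠ 0 →
    HasDerivAt Q (-(Q u / (c ^ 2 - 2 * ζ u)) ^ 2 - ζ u) u

namespace IsFluxSystem

variable {c : ℝ} {ζ Q : ℝ → ℝ}

/-- With r = √(c² − 2ζ) and dψ = du/r, the pair (ζ, Q/r) rotates at unit speed. Zero flux at the
crest gives ζ = ζ(0) cos ψ, and zero flux at the trough quantises ψ(π). -/
theorem exists_angle (h : IsFluxSystem c ζ Q) (hw : ∀ u, 0 < c ^ 2 - 2 * ζ u) (h0 : Q 0 = 0)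
    (hpi : Q Real.pi = 0) :
    ζ 0 ∈ Ioo 0 (c ^ 2 / 2) ∧ halfPeriod c (ζ 0) = Real.pi ∧
      ∀ u ∈ Icc 0 Real.pi, ∃ ψ, time (smoothDensity c (ζ 0)) ψ = u ∧ ζ u = ζ 0 * Real.cos ψ := by
  have hπ := Real.pi_pos
  have hζ := h.continuous
  have hr : ∀ u, 0 < √(c ^ 2 - 2 * ζ u) := fun u => Real.sqrt_pos.2 (hw u)
  have hr2 : ∀ u, √(c ^ 2 - 2 * ζ u) ^ 2 = c ^ 2 - 2 * ζ u := fun u => Real.sq_sqrt (hw u).le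
  set r := fun u => √(c ^ 2 - 2 * ζ u) with hrdef
  have hrc : Continuous r := by fun_prop
  have hic : Continuous fun u => (r u)⁻¹ := hrc.inv₀ fun u => (hr u).ne'
  set ψ := time fun u => (r u)⁻¹ with hψdef
  have hψ : ∀ u, HasDerivAt ψ (r u)⁻¹ u := fun u => hasDerivAt_time hic u
  have hψc : Continuous ψ := continuous_iff_continuousAt.2 fun u => (hψ u).continuousAt
  have hψ0 : ψ 0 = 0 := time_zero _
  have hY : ∀ u ∈ Ioo 0 Real.pi, HasDerivAt (fun v => Q v / r v) (-ζ u / r u) u := by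
    intro u hu
    have hz := h.hasDerivAt u hu (hw u).ne'
    have hrd : HasDerivAt r (-(Q u / r u ^ 2) / r u) u := by
      convert! ((hz.const_mul 2).const_sub (c ^ 2)).sqrt (hw u).ne' using 1
      change _ = _ / (2 * r u)
      have := (hr u).ne'
      rw [hr2]
      field_simp
    have hQ := h.hasDerivAt_flux u hu (hw u).ne'
    rw [← hr2] at hQ
    convert! hQ.div hrd (hr u).ne' using 1
    change _ = ((-(Q u / r u ^ 2) ^ 2 - ζ u) * r u - Q u * (-(Q u / r u ^ 2) / r u)) / r u ^ 2
    have : r u ≠ 0 := (hr u).ne'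
    field_simp
    ring
  have hz : ∀ u ∈ Ioo 0 Real.pi, HasDerivAt ζ ((Q u / r u) / r u) u := by
    intro u hu
    convert! h.hasDerivAt u hu (hw u).ne' using 1
    rw [← hr2, div_div, sq]
  have hYc : ContinuousOn (fun v => Q v / r v) (Icc 0 Real.pi) :=
    h.continuous_flux.div hrc.continuousOn fun u _ => (hr u).ne'
  -- The pair rotated back by the angle ψ is constant.
  have hG1 := eq_left_of_hasDerivAt_zero
    (f := fun u => ζ u * Real.cos (ψ u) - Q u / r u * Real.sin (ψ u))
    ((hζ.mul (Real.continuous_cos.comp hψc)).continuousOn.sub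
      (hYc.mul (Real.continuous_sin.comp hψc).continuousOn))
    (fun u hu => ((hz u hu).mul (hψ u).cos).sub ((hY u hu).mul (hψ u).sin))
    (fun u hu => by ring)
  have hG2 := eq_left_of_hasDerivAt_zero
    (f := fun u => ζ u * Real.sin (ψ u) + Q u / r u * Real.cos (ψ u))
    ((hζ.mul (Real.continuous_sin.comp hψc)).continuousOn.add
      (hYc.mul (Real.continuous_cos.comp hψc).continuousOn))
    (fun u hu => ((hz u hu).mul (hψ u).sin).add ((hY u hu).mul (hψ u).cos))
    (fun u hu => by ring)
  simp only [hψ0, h0, Real.cos_zero, Real.sin_zero, mul_one, mul_zero, sub_zero, zero_div,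
    add_zero] at hG1 hG2
  set a := ζ 0
  have hcos : ∀ u ∈ Icc 0 Real.pi, ζ u = a * Real.cos (ψ u) := by
    intro u hu
    linear_combination Real.cos (ψ u) * hG1 u hu + Real.sin (ψ u) * hG2 u hu
      - ζ u * Real.sin_sq_add_cos_sq (ψ u)
  have hpimem : Real.pi ∈ Icc 0 Real.pi := ⟨hπ.le, le_rfl⟩
  have h0mem : (0 : ℝ) ∈ Icc 0 Real.pi := ⟨le_rfl, hπ.le⟩
  have ha : 0 < a := by
    by_contra! hle
    have h1 : ζ Real.pi < a := h.strictAntiOn h0mem hpimem hπ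
    rw [hcos _ hpimem] at h1
    nlinarith [Real.cos_le_one (ψ Real.pi)]
  have ha' : a ∈ Ioo 0 (c ^ 2 / 2) := ⟨ha, by linarith [hw 0]⟩
  have hsin : Real.sin (ψ Real.pi) = 0 := by
    have h1 := hG1 _ hpimem
    have h2 := hG2 _ hpimem
    rw [hpi, zero_div, zero_mul, add_zero] at h2
    rw [hcos _ hpimem, hpi, zero_div, zero_mul, sub_zero] at h1
    rcases mul_eq_zero.1 h2 with h3 | h3
    · rw [hcos _ hpimem] at h3
      rw [h3, zero_mul] at h1
      linarith
    · exact h3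
  have hψmono : StrictMono ψ := by
    refine strictMono_time hic (fun t => (inv_pos.2 (hr t)).le) ?_
    convert! countable_empty (α := ℝ)
    exact eq_empty_of_forall_notMem fun t ht => (inv_pos.2 (hr t)).ne' ht
  have hψpi : ψ Real.pi = Real.pi := by
    obtain ⟨n, hn⟩ := Real.sin_eq_zero_iff.1 hsin
    have hpos : 0 < ψ Real.pi := by rw [← hψ0]; exact hψmono hπ
    have hn0 : 0 < n := by
      have : (0 : ℝ) < n := by
        rw [← hn] at hpos
        exact pos_of_mul_pos_left hpos hπ.le
      exact_mod_cast this
    -- If ψ(π) were at least 2π, ζ would return to its crest value inside the half period.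
    have hn2 : n < 2 := by
      by_contra! hle
      have hle' : (2 : ℝ) ≤ n := by exact_mod_cast hle
      obtain ⟨u, hu, hu2⟩ := intermediate_value_Icc hπ.le hψc.continuousOn
        (show 2 * Real.pi ∈ Icc (ψ 0) (ψ Real.pi) from by
          rw [hψ0, ← hn]; exact ⟨by positivity, by nlinarith⟩)
      have hu0 : 0 < u := by
        rcases hu.1.eq_or_lt with rfl | h'
        · rw [hψ0] at hu2; linarith
        · exact h'
      have h1 : ζ u < a := h.strictAntiOn h0mem hu hu0
      rw [hcos u hu, hu2, Real.cos_two_pi, mul_one] at h1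
      exact lt_irrefl _ h1
    have : n = 1 := by omega
    rw [← hn, this, Int.cast_one, one_mul]
  have htime : ∀ u ∈ Icc 0 Real.pi, time (smoothDensity c a) (ψ u) = u := by
    have hU := hasDerivAt_time (continuous_smoothDensity c a)
    have key := eq_left_of_hasDerivAt_zero (f := fun u => time (smoothDensity c a) (ψ u) - u)
      (a := 0) (b := Real.pi) (f' := fun u => smoothDensity c a (ψ u) * (r u)⁻¹ - 1)
      ((continuous_iff_continuousAt.2 fun x => (hU x).continuousAt).comp hψc
        |>.sub continuous_id).continuousOn
      (fun u _ => ((hU (ψ u)).comp u (hψ u)).sub (hasDerivAt_id u)) (fun u hu => by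
        have h1 : smoothDensity c a (ψ u) = r u := by
          rw [smoothDensity, mul_assoc, ← hcos u (Ioo_subset_Icc_self hu)]
        rw [h1, mul_inv_cancel₀ (hr u).ne', sub_self])
    intro u hu
    have := key u hu
    simp only [hψ0, time_zero, sub_zero] at this
    linarith
  refine ⟨ha', ?_, fun u hu => ⟨ψ u, htime u hu, hcos u hu⟩⟩
  have := htime _ hpimem
  rwa [hψpi] at this

/-- Above the critical level c² − 2ζ < 0 and ζ > 0 near the crest, so the flux decreases from 0 and
the slope Q/(c² − 2ζ) is positive, against monotonicity. -/
theorem not_lt (h : IsFluxSystem c ζ Q) (h0 : Q 0 = 0) : ¬ c ^ 2 / 2 < ζ 0 := by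
  intro hlt
  have hπ := Real.pi_pos
  obtain ⟨ε, hε, H⟩ := Metric.eventually_nhds_iff.1
    (h.continuous.continuousAt.eventually_const_lt hlt)
  set δ := min (ε / 2) Real.pi
  have hδ : 0 < δ := by positivity
  have hδε : δ < ε := (min_le_left _ _).trans_lt (by linarith)
  have hδπ : δ ≤ Real.pi := min_le_right _ _
  have hw : ∀ u ∈ Icc 0 δ, c ^ 2 - 2 * ζ u < 0 := by
    intro u hu
    have := H (y := u) (by rw [Real.dist_eq, sub_zero, abs_of_nonneg hu.1]; linarith [hu.2])
    linarith
  have hsub : Icc 0 δ ⊆ Icc 0 Real.pi := Icc_subset_Icc_right hδπ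
  have hmem : ∀ u ∈ Ioo 0 δ, u ∈ Ioo 0 Real.pi := fun u hu => ⟨hu.1, hu.2.trans_le hδπ⟩
  have hQ : StrictAntiOn Q (Icc 0 δ) := by
    refine strictAntiOn_of_deriv_neg (convex_Icc _ _) (h.continuous_flux.mono hsub) fun u hu => ?_
    rw [interior_Icc] at hu
    have := hw u (Ioo_subset_Icc_self hu)
    rw [(h.hasDerivAt_flux u (hmem u hu) this.ne).deriv]
    nlinarith [sq_nonneg (Q u / (c ^ 2 - 2 * ζ u)), sq_nonneg c]
  have hζ : StrictMonoOn ζ (Icc 0 δ) := by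
    refine strictMonoOn_of_deriv_pos (convex_Icc _ _) h.continuous.continuousOn fun u hu => ?_
    rw [interior_Icc] at hu
    have := hw u (Ioo_subset_Icc_self hu)
    rw [(h.hasDerivAt u (hmem u hu) this.ne).deriv]
    refine div_pos_of_neg_of_neg ?_ this
    rw [← h0]
    exact hQ ⟨le_rfl, hδ.le⟩ (Ioo_subset_Icc_self hu) hu.1
  have h1 := hζ ⟨le_rfl, hδ.le⟩ ⟨hδ.le, le_rfl⟩ hδ
  have h2 := h.strictAntiOn ⟨le_rfl, hπ.le⟩ ⟨hδ.le, hδπ⟩ hδ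
  linarith

/-- A profile with bounded slope that reaches the level `c² / 2` has zero excess energy. -/
theorem energy_eq (h : IsFluxSystem c ζ Q) (h0 : ζ 0 = c ^ 2 / 2) {K : ℝ}
    (hK : ∀ u ∈ Ioo 0 Real.pi, |Q u / (c ^ 2 - 2 * ζ u)| ≤ K) {y : ℝ} (hy : y ∈ Ioo 0 Real.pi) :
    ζ y ^ 2 + (c ^ 2 - 2 * ζ y) * (Q y / (c ^ 2 - 2 * ζ y)) ^ 2 = c ^ 4 / 4 := by
  have hπ := Real.pi_pos
  have hw : ∀ u ∈ Ioc 0 y, 0 < c ^ 2 - 2 * ζ u := by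
    intro u hu
    have := h.strictAntiOn ⟨le_rfl, hπ.le⟩ ⟨hu.1.le, hu.2.trans hy.2.le⟩ hu.1
    linarith
  have hmem : ∀ u ∈ Ioc 0 y, u ∈ Ioo 0 Real.pi := fun u hu => ⟨hu.1, hu.2.trans_lt hy.2⟩
  have hζ := h.continuous
  have key := eq_left_of_hasDerivAt_zero (a := 0) (b := y)
    (f := fun u => ζ u ^ 2 + (c ^ 2 - 2 * ζ u) * (Q u / (c ^ 2 - 2 * ζ u)) ^ 2)
    (f' := fun u => deriv (fun u => ζ u ^ 2 + (c ^ 2 - 2 * ζ u) * (Q u / (c ^ 2 - 2 * ζ u)) ^ 2) u)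
    ?_ ?_ ?_ y ⟨hy.1.le, le_rfl⟩
  · simp only [h0] at key
    rw [key]
    ring
  -- Bounded slope makes (c² − 2ζ)ζ'² tend to 0 at the crest. This is where the |u|^(2/3) cusps are
  -- excluded.
  · refine hζ.continuousOn.pow 2 |>.add fun u hu => ?_
    rcases hu.1.eq_or_lt with rfl | hu0
    · have hw0 : c ^ 2 - 2 * ζ 0 = 0 := by rw [h0]; ring
      rw [ContinuousWithinAt, hw0, zero_mul]
      have hlim : Tendsto (fun u => (c ^ 2 - 2 * ζ u) * K ^ 2) (𝓝[Icc 0 y] 0) (𝓝 0) := by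
        have : Tendsto (fun u => (c ^ 2 - 2 * ζ u) * K ^ 2) (𝓝 0)
            (𝓝 ((c ^ 2 - 2 * ζ 0) * K ^ 2)) := Continuous.tendsto (by fun_prop) 0
        rw [hw0, zero_mul] at this
        exact this.mono_left nhdsWithin_le_nhds
      refine squeeze_zero_norm' ?_ hlim
      filter_upwards [self_mem_nhdsWithin] with u hu
      rcases hu.1.eq_or_lt with rfl | hu0
      · simp [hw0]
      · have hwu := hw u ⟨hu0, hu.2⟩
        rw [Real.norm_of_nonneg (by positivity)]
        refine mul_le_mul_of_nonneg_left ?_ hwu.le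
        exact sq_le_sq' (abs_le.1 (hK u (hmem u ⟨hu0, hu.2⟩))).1
          (abs_le.1 (hK u (hmem u ⟨hu0, hu.2⟩))).2
    · have hQ : ContinuousWithinAt Q (Icc 0 y) u :=
        (h.continuous_flux u ⟨hu.1, hu.2.trans hy.2.le⟩).mono (Icc_subset_Icc_right hy.2.le)
      have hwc : ContinuousWithinAt (fun u => c ^ 2 - 2 * ζ u) (Icc 0 y) u :=
        Continuous.continuousWithinAt (by fun_prop)
      exact hwc.mul ((hQ.div hwc (hw u ⟨hu0, hu.2⟩).ne').pow 2)
  all_goals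
    intro u hu
    have hu' := Ioo_subset_Ioc_self hu
    have hwu := (hw u hu').ne'
    have d1 := h.hasDerivAt u (hmem u hu') hwu
    have dw := (d1.const_mul 2).const_sub (c ^ 2)
    have d2 := (h.hasDerivAt_flux u (hmem u hu') hwu).div dw hwu
    have d3 := (d1.pow 2).add (dw.mul (d2.pow 2))
  · exact d3.differentiableAt.hasDerivAt
  · refine d3.deriv.trans ?_
    simp only [Pi.div_apply, Pi.pow_apply, Nat.add_one_sub_one, pow_one, Nat.cast_ofNat]
    generalize c ^ 2 - 2 * ζ u = w at hwu ⊢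
    field_simp
    ring

/-- At energy c⁴/4 the factor c² − 2ζ cancels, leaving ζ'² = (c²/2 + ζ)/2. On the decreasing branch
√(c²/2 + ζ) is affine with slope −1/(2√2). -/
theorem eq_of_eq (h : IsFluxSystem c ζ Q) (hc : 0 < c) (h0 : ζ 0 = c ^ 2 / 2) {K : ℝ}
    (hK : ∀ u ∈ Ioo 0 Real.pi, |Q u / (c ^ 2 - 2 * ζ u)| ≤ K) {u : ℝ} (hu : u ∈ Icc 0 Real.pi) :
    ζ u = (c - u / (2 * √2)) ^ 2 - c ^ 2 / 2 := by
  have hπ := Real.pi_pos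
  have hζ := h.continuous
  have hw : ∀ u ∈ Ioo 0 Real.pi, 0 < c ^ 2 - 2 * ζ u := by
    intro u hu
    have := h.strictAntiOn ⟨le_rfl, hπ.le⟩ (Ioo_subset_Icc_self hu) hu.1
    linarith
  have hsq : ∀ u ∈ Ioo 0 Real.pi, (Q u / (c ^ 2 - 2 * ζ u)) ^ 2 = (c ^ 2 / 2 + ζ u) / 2 := by
    intro u hu
    refine mul_left_cancel₀ (hw u hu).ne' ?_
    linear_combination h.energy_eq h0 hK hu
  -- The identity for the squared slope gives only ≥ 0; applying it at a point further right and
  -- using strict decrease gives strict positivity.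
  have hpos : ∀ u ∈ Ioo 0 Real.pi, 0 < c ^ 2 / 2 + ζ u := by
    intro u hu
    have hv : (u + Real.pi) / 2 ∈ Ioo 0 Real.pi := ⟨by linarith [hu.1], by linarith [hu.2]⟩
    have h1 := h.strictAntiOn (Ioo_subset_Icc_self hu) (Ioo_subset_Icc_self hv) (by linarith [hu.2])
    nlinarith [hsq _ hv, sq_nonneg (Q ((u + Real.pi) / 2) / (c ^ 2 - 2 * ζ ((u + Real.pi) / 2)))]
  have hneg : ∀ u ∈ Ioo 0 Real.pi, Q u / (c ^ 2 - 2 * ζ u) ≤ 0 := by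
    intro u hu
    have := (h.strictAntiOn.antitoneOn.mono Ioo_subset_Icc_self).derivWithin_nonpos (x := u)
    rwa [derivWithin_of_isOpen isOpen_Ioo hu, (h.hasDerivAt u hu (hw u hu).ne').deriv] at this
  have h2 : 0 < √2 := by positivity
  have h22 : √2 ^ 2 = 2 := Real.sq_sqrt (by norm_num)
  have key := eq_left_of_hasDerivAt_zero (a := 0) (b := Real.pi)
    (f := fun u => √(c ^ 2 / 2 + ζ u) + u / (2 * √2))
    (f' := fun u => Q u / (c ^ 2 - 2 * ζ u) / (2 * √(c ^ 2 / 2 + ζ u)) + 1 / (2 * √2))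
    (Continuous.continuousOn (by fun_prop))
    (fun u hu => (((h.hasDerivAt u hu (hw u hu).ne').const_add _).sqrt (hpos u hu).ne').add
      ((hasDerivAt_id u).div_const _)) fun u hu => by
    have hv : 0 < √(c ^ 2 / 2 + ζ u) := Real.sqrt_pos.2 (hpos u hu)
    have hv2 : √(c ^ 2 / 2 + ζ u) ^ 2 = c ^ 2 / 2 + ζ u := Real.sq_sqrt (hpos u hu).le
    have h3 := hsq u hu
    have h4 := hneg u hu
    set D := Q u / (c ^ 2 - 2 * ζ u)
    set v := √(c ^ 2 / 2 + ζ u)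
    have h5 : -D * √2 = v := by
      refine (sq_eq_sq₀ (mul_nonneg (by linarith) h2.le) hv.le).1 ?_
      rw [mul_pow, neg_sq, h3, hv2, h22]
      ring
    rw [← h5]
    have hD : D ≠ 0 := by
      rintro hD
      rw [hD] at h5
      simp only [neg_zero, zero_mul] at h5
      exact hv.ne h5
    field_simp
    ring
  have hform : EqOn ζ (fun u => (c - u / (2 * √2)) ^ 2 - c ^ 2 / 2) (Ioo 0 Real.pi) := by
    intro u hu
    have h1 := key u (Ioo_subset_Icc_self hu)
    simp only [h0, add_halves, Real.sqrt_sq hc.le, zero_div, add_zero] at h1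
    have hv2 : √(c ^ 2 / 2 + ζ u) ^ 2 = c ^ 2 / 2 + ζ u := Real.sq_sqrt (hpos u hu).le
    simp only
    rw [← eq_sub_of_add_eq h1, hv2]
    ring
  refine hform.of_subset_closure hζ.continuousOn (Continuous.continuousOn (by fun_prop))
    Ioo_subset_Icc_self ?_ hu
  rw [closure_Ioo hπ.ne]

end IsFluxSystem

/-! ### Uniqueness of the smooth waves -/

theorem IsSmoothWave.exists_angle {c : ℝ} {ζ : ℝ → ℝ} (hc : 0 < c) (h : IsSmoothWave c ζ) :
    ζ 0 ∈ Ioo 0 (c ^ 2 / 2) ∧ halfPeriod c (ζ 0) = Real.pi ∧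
      ∀ u ∈ Icc 0 Real.pi, ∃ ψ, time (smoothDensity c (ζ 0)) ψ = u ∧ ζ u = ζ 0 * Real.cos ψ := by
  obtain ⟨hl, hs, hcl⟩ := h
  have hπ := Real.pi_pos
  have ha := hl.strictAntiOn hs.continuous
  have hd0 : deriv ζ 0 = 0 := ((hl.isLocalMax_iff 0).2 zero_mem_lattice).deriv_eq_zero
  have hdpi : deriv ζ Real.pi = 0 := by
    refine IsLocalMin.deriv_eq_zero (Eventually.of_forall fun u => ?_)
    obtain ⟨v, hv, k, hk⟩ := exists_reduction u
    rw [apply_reduction hl.periodic hl.even hk]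
    exact ha.antitoneOn hv ⟨hπ.le, le_rfl⟩ hv.2
  have hsys : IsFluxSystem c ζ fun u => (c ^ 2 - 2 * ζ u) * deriv ζ u := by
    refine ⟨hs.continuous, Continuous.continuousOn ?_, ha, fun u _ hw => ?_,
      fun u _ hw => ?_⟩
    · have := hs.continuous
      have := hs.continuous_deriv (by exact_mod_cast le_top)
      fun_prop
    · rw [mul_div_cancel_left₀ _ hw]
      exact (hcl u).hasDerivAt
    · rw [mul_div_cancel_left₀ _ hw]
      exact (hcl u).hasDerivAt_flux
  have hQ0 : (c ^ 2 - 2 * ζ 0) * deriv ζ 0 = 0 := by rw [hd0, mul_zero]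
  -- At a smooth crest of height c²/2 the equation would reduce to ζ(0) = 0.
  have hlt : ζ 0 < c ^ 2 / 2 := by
    refine lt_of_le_of_ne (not_lt.1 (hsys.not_lt hQ0)) fun heq => ?_
    have := (hcl 0).2
    rw [hd0, heq] at this
    nlinarith
  refine hsys.exists_angle (fun u => ?_) hQ0 (by rw [hdpi, mul_zero])
  linarith [apply_le_zero_of_strictAntiOn hl.periodic hl.even ha u]

/-- The half period determines the amplitude, and strict monotonicity of the clock then determines
the angle at each u. -/
theorem IsSmoothWave.unique {c : ℝ} {ζ η : ℝ → ℝ} (hc : 0 < c) (hζ : IsSmoothWave c ζ)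
    (hη : IsSmoothWave c η) : ζ = η := by
  obtain ⟨ha, hT, H⟩ := hζ.exists_angle hc
  obtain ⟨ha', hT', H'⟩ := hη.exists_angle hc
  have hamp : ζ 0 = η 0 := (strictAntiOn_halfPeriod c).injOn (Ioo_subset_Icc_self ha)
    (Ioo_subset_Icc_self ha') (hT.trans hT'.symm)
  refine eq_of_eqOn_of_periodic_of_even hζ.1.periodic hζ.1.even hη.1.periodic hη.1.even
    fun u hu => ?_
  obtain ⟨ψ, h1, h2⟩ := H u hu
  obtain ⟨ψ', h1', h2'⟩ := H' u hu
  rw [← hamp] at h1' h2'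
  rw [h2, h2', (strictMono_time_smoothDensity ha).injective (h1.trans h1'.symm)]

/-! ### Weak derivatives on the torus -/

/-- This lets localisation by compactly supported bumps be applied with periodic test functions.
Smoothness at the seam holds because the function vanishes near both endpoints. -/
theorem exists_periodic_extension {g : ℝ → ℝ} (hg : ContDiff ℝ ((⊤ : ℕ∞) : WithTop ℕ∞) g)
    (hsupp : tsupport g ⊆ Ioo (-Real.pi) Real.pi) :
    ∃ P, IsTestFunction P ∧ ∀ u ∈ Ioc (-Real.pi) Real.pi, P u = g u := by
  have h2π : (0 : ℝ) < 2 * Real.pi := by positivity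
  have hπ := Real.pi_pos
  set P := fun u => g (toIocMod h2π (-Real.pi) u) with hP
  have hPg : ∀ u ∈ Ioc (-Real.pi) Real.pi, P u = g u := by
    intro u hu
    have : toIocMod h2π (-Real.pi) u = u := (toIocMod_eq_self h2π).2 ⟨hu.1, by linarith [hu.2]⟩
    rw [hP]
    simp only [this]
  have hper : Function.Periodic P (2 * Real.pi) := fun u => by
    simp only [hP, toIocMod_add_right]
  refine ⟨P, ⟨contDiff_iff_contDiffAt.2 fun u => ?_, hper⟩, hPg⟩
  have hlocal : ∀ v ∈ Ioc (-Real.pi) Real.pi, ContDiffAt ℝ ((⊤ : ℕ∞) : WithTop ℕ∞) P v := by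
    intro v hv
    rcases hv.2.eq_or_lt with rfl | hlt
    · have hz : P =ᶠ[𝓝 Real.pi] fun _ => 0 := by
        have e1 : ∀ᶠ y in 𝓝 Real.pi, y ∈ (tsupport g)ᶜ :=
          (isClosed_tsupport g).isOpen_compl.mem_nhds fun hmem => lt_irrefl _ (hsupp hmem).2
        have e2 : ∀ᶠ y in 𝓝 Real.pi, y - 2 * Real.pi ∈ (tsupport g)ᶜ := by
          refine (by fun_prop : Continuous fun y : ℝ => y - 2 * Real.pi).continuousAt.eventually_mem
            ((isClosed_tsupport g).isOpen_compl.mem_nhds fun hmem => ?_)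
          have := (hsupp hmem).1
          linarith
        have e3 : ∀ᶠ y in 𝓝 Real.pi, y ∈ Ioo (-Real.pi) (3 * Real.pi) :=
          Ioo_mem_nhds (by linarith) (by linarith)
        filter_upwards [e1, e2, e3] with y h1 h2 h3
        rcases le_or_gt y Real.pi with hy | hy
        · rw [hPg y ⟨h3.1, hy⟩]
          exact image_eq_zero_of_notMem_tsupport h1
        · rw [← hper.sub_eq, hPg _ ⟨by linarith, by linarith [h3.2]⟩]
          exact image_eq_zero_of_notMem_tsupport h2
      exact contDiffAt_const.congr_of_eventuallyEq hz
    · refine hg.contDiffAt.congr_of_eventuallyEq ?_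
      filter_upwards [Ioo_mem_nhds hv.1 hlt] with y hy using hPg y (Ioo_subset_Ioc_self hy)
  obtain ⟨k, hk⟩ : ∃ k : ℤ, u - k * (2 * Real.pi) ∈ Ioc (-Real.pi) Real.pi := by
    refine ⟨toIocDiv h2π (-Real.pi) u, ?_⟩
    have := toIocMod_mem_Ioc h2π (-Real.pi) u
    rw [toIocMod, zsmul_eq_mul] at this
    exact ⟨this.1, by linarith [this.2]⟩
  have heq : P = fun y => P (y - k * (2 * Real.pi)) := funext fun y => (hper.sub_int_mul_eq k).symm
  rw [heq]
  exact ContDiffAt.comp (g := P) (f := fun y => y - k * (2 * Real.pi)) u (hlocal _ hk)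
    (contDiffAt_id.sub contDiffAt_const)

theorem ae_eq_zero_of_integral_mul_test {F : ℝ → ℝ} (hF : Integrable F torusMeasure)
    (h : ∀ φ, IsTestFunction φ → ∫ u, F u * φ u ∂torusMeasure = 0) : F =ᵐ[torusMeasure] 0 := by
  have hloc := isOpen_Ioo.ae_eq_zero_of_integral_contDiff_smul_eq_zero (μ := torusMeasure)
    (U := Ioo (-Real.pi) Real.pi) (hF.locallyIntegrable.locallyIntegrableOn _)
    fun g hg _ hsupp => by
      obtain ⟨P, hP, hPg⟩ := exists_periodic_extension hg hsupp
      rw [← h P hP]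
      refine setIntegral_congr_fun measurableSet_Ioc fun u hu => ?_
      simp only [smul_eq_mul, hPg u hu, mul_comm]
  have hne : ∀ᵐ u ∂torusMeasure, u ≠ Real.pi :=
    ae_restrict_of_ae ((countable_singleton Real.pi).ae_notMem _)
  have hmem : ∀ᵐ u ∂torusMeasure, u ∈ Ioc (-Real.pi) Real.pi := ae_restrict_mem measurableSet_Ioc
  filter_upwards [hloc, hne, hmem] with u h1 h2 h3
  exact h1 ⟨h3.1, lt_of_le_of_ne h3.2 h2⟩

theorem isTestFunction_const (a : ℝ) : IsTestFunction fun _ => a :=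
  ⟨contDiff_const, fun _ => rfl⟩

/-- The primitive of a test function of mean zero is a test function. -/
theorem IsTestFunction.time {φ : ℝ → ℝ} (hφ : IsTestFunction φ)
    (h0 : ∫ u in (-Real.pi)..Real.pi, φ u = 0) : IsTestFunction (time φ) := by
  have hc := hφ.smooth.continuous
  refine ⟨contDiff_iff_contDiffAt.2 fun u => contDiffAt_time hc hφ.smooth.contDiffAt, fun u => ?_⟩
  have h1 := hφ.periodic.intervalIntegral_add_eq u (-Real.pi)
  rw [show -Real.pi + 2 * Real.pi = Real.pi by ring, h0] at h1
  rw [StokesWave.time, StokesWave.time, ← intervalIntegral.integral_add_adjacent_intervals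
    (hc.intervalIntegrable 0 u) (hc.intervalIntegrable u _), h1, add_zero]

/-- The lemma of du Bois-Reymond on the torus: a weakly differentiable function is almost
everywhere equal to a continuous periodic primitive of its weak derivative. -/
theorem HasWeakDeriv.exists_primitive {f h : ℝ → ℝ} (hw : HasWeakDeriv f h) :
    ∃ H : ℝ → ℝ, Continuous H ∧ H (-Real.pi) = H Real.pi ∧ f =ᵐ[torusMeasure] H ∧
      ∀ x ∈ Icc (-Real.pi) Real.pi, ∀ y ∈ Icc (-Real.pi) Real.pi,
        H y - H x = ∫ t in x..y, h t := by
  obtain ⟨hf, hh, hw⟩ := hw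
  have hπ := Real.pi_pos
  have hle : -Real.pi ≤ Real.pi := by linarith
  have hhi := integrable_torusMeasure.1 hh
  set k := (Ioc (-Real.pi) Real.pi).indicator h
  have hk : Integrable k := (integrable_indicator_iff measurableSet_Ioc).2 hh
  have hki : ∀ a b, IntervalIntegrable k volume a b := fun a b => hk.intervalIntegrable
  have hkh : ∀ x ∈ Icc (-Real.pi) Real.pi, ∀ y ∈ Icc (-Real.pi) Real.pi,
      ∫ t in x..y, k t = ∫ t in x..y, h t := by
    intro x hx y hy
    refine intervalIntegral.integral_congr_ae (Eventually.of_forall fun t ht => ?_)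
    have hmem : t ∈ Ioc (-Real.pi) Real.pi :=
      ⟨(le_min hx.1 hy.1).trans_lt ht.1, ht.2.trans (max_le hx.2 hy.2)⟩
    exact Set.indicator_of_mem hmem h
  have hmean : ∫ t in (-Real.pi)..Real.pi, h t = 0 := by
    have := hw _ (isTestFunction_const 1)
    simp only [deriv_const, mul_zero, integral_zero, mul_one] at this
    rw [← integral_torusMeasure]
    linarith
  set G := fun u => ∫ t in (-Real.pi)..u, k t with hG
  have hGc : Continuous G := intervalIntegral.continuous_primitive hki _
  have hG0 : G (-Real.pi) = 0 := intervalIntegral.integral_same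
  have hGπ : G Real.pi = 0 := by
    rw [hG]
    simp only
    rw [hkh _ ⟨le_rfl, hle⟩ _ ⟨hle, le_rfl⟩, hmean]
  have hGd : ∀ᵐ u, u ∈ uIoc (-Real.pi) Real.pi → deriv G u = h u := by
    filter_upwards [(hki (-Real.pi) Real.pi).ae_hasDerivAt_integral] with u hu hmem
    rw [(hu (uIoc_subset_uIcc hmem) (-Real.pi) left_mem_uIcc).deriv]
    rw [uIoc_of_le hle] at hmem
    exact Set.indicator_of_mem hmem h
  -- The primitive is differentiable only almost everywhere, so integration by parts goes through
  -- absolute continuity.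
  have hGac : AbsolutelyContinuousOnInterval G (-Real.pi) Real.pi :=
    (hki _ _).absolutelyContinuousOnInterval_intervalIntegral left_mem_uIcc
  have hparts : ∀ φ, IsTestFunction φ →
      ∫ u in (-Real.pi)..Real.pi, G u * deriv φ u = -∫ u in (-Real.pi)..Real.pi, h u * φ u := by
    intro φ hφ
    have hφac : AbsolutelyContinuousOnInterval φ (-Real.pi) Real.pi :=
      (hφ.smooth.of_le (by exact_mod_cast le_top)).contDiffOn.absolutelyContinuousOnInterval
    rw [hGac.integral_mul_deriv_eq_deriv_mul hφac, hG0, hGπ, zero_mul, zero_mul, sub_zero, zero_sub]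
    congr 1
    refine intervalIntegral.integral_congr_ae ?_
    filter_upwards [hGd] with u hu hmem
    rw [hu hmem]
  have hfG : Integrable (fun u => f u - G u) torusMeasure :=
    hf.sub (integrable_torusMeasure.2 (hGc.intervalIntegrable _ _))
  have hfGi := integrable_torusMeasure.1 hfG
  set M := (2 * Real.pi)⁻¹ * ∫ u in (-Real.pi)..Real.pi, (f u - G u) with hM
  have hzero := ae_eq_zero_of_integral_mul_test (F := fun u => f u - G u - M)
    (hfG.sub (integrable_const M)) fun φ hφ => by
      have hφc := hφ.smooth.continuous
      -- After removal of its mean, φ is the derivative of a periodic test function. Hence f − G is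
      -- orthogonal to every test function of mean zero, and so is the constant M almost everywhere.
      set m := (2 * Real.pi)⁻¹ * ∫ u in (-Real.pi)..Real.pi, φ u with hm
      have hψ : IsTestFunction fun u => φ u - m :=
        ⟨hφ.smooth.sub contDiff_const, fun u => by simp only [hφ.periodic u]⟩
      have hψc := hψ.smooth.continuous
      have hψ0 : ∫ u in (-Real.pi)..Real.pi, (φ u - m) = 0 := by
        rw [intervalIntegral.integral_sub (hφc.intervalIntegrable _ _)
          intervalIntegrable_const, intervalIntegral.integral_const, hm, smul_eq_mul]
        field_simp
        ring
      have hprim := hψ.time hψ0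
      have hd : deriv (time fun u => φ u - m) = fun u => φ u - m :=
        funext fun u => (hasDerivAt_time hψc u).deriv
      have h1 := hw _ hprim
      have h2 := hparts _ hprim
      rw [integral_torusMeasure, integral_torusMeasure, ← h2, hd] at h1
      have if1 := (integrable_torusMeasure.1 hf).mul_continuousOn hψc.continuousOn
      have ig1 := ((hGc.intervalIntegrable (μ := volume) (-Real.pi) Real.pi)).mul_continuousOn
        hψc.continuousOn
      have h3 : ∫ u in (-Real.pi)..Real.pi, (f u - G u) * (φ u - m) = 0 := by
        simp only [sub_mul _ _ (φ _ - m)]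
        rw [intervalIntegral.integral_sub if1 ig1, h1, sub_self]
      have i1 := hfGi.mul_continuousOn hφc.continuousOn
      have h4 : ∫ u in (-Real.pi)..Real.pi, (f u - G u) * φ u =
          m * ∫ u in (-Real.pi)..Real.pi, (f u - G u) := by
        simp only [mul_sub _ (φ _)] at h3
        rw [intervalIntegral.integral_sub i1 (hfGi.mul_const m),
          intervalIntegral.integral_mul_const] at h3
        linarith
      rw [integral_torusMeasure]
      simp only [sub_mul _ M]
      rw [intervalIntegral.integral_sub i1 ((hφc.intervalIntegrable _ _).const_mul M), h4,
        intervalIntegral.integral_const_mul, hm, hM]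
      ring
  refine ⟨fun u => M + G u, continuous_const.add hGc, by simp only [hG0, hGπ], ?_, ?_⟩
  · filter_upwards [hzero] with u hu
    simp only [Pi.zero_apply] at hu
    linarith
  · intro x hx y hy
    rw [← hkh x hx y hy, ← intervalIntegral.integral_add_adjacent_intervals
      (hki x (-Real.pi)) (hki (-Real.pi) y), intervalIntegral.integral_symm (-Real.pi) x]
    simp only [hG]
    ring

theorem HasWeakDeriv.sub_eq_integral {ζ g : ℝ → ℝ} (hζ : Continuous ζ) (h : HasWeakDeriv ζ g)
    {x y : ℝ} (hx : x ∈ Ioo (-Real.pi) Real.pi) (hy : y ∈ Ioo (-Real.pi) Real.pi) :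
    ζ y - ζ x = ∫ t in x..y, g t := by
  obtain ⟨H, hH, -, hae, hint⟩ := h.exists_primitive
  have heq : EqOn ζ H (Ioc (-Real.pi) Real.pi) :=
    Measure.eqOn_Ioc_of_ae_eq volume hae hζ.continuousOn hH.continuousOn
  rw [heq (Ioo_subset_Ioc_self hx), heq (Ioo_subset_Ioc_self hy)]
  exact hint x (Ioo_subset_Icc_self hx) y (Ioo_subset_Icc_self hy)

/-- A primitive of `k` is differentiable where `k` has a continuous representative. -/
theorem hasDerivAt_of_ae_eq {F k κ : ℝ → ℝ} {W : Set ℝ} (hW : IsOpen W)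
    (hsub : W ⊆ Ioo (-Real.pi) Real.pi)
    (hF : ∀ x ∈ Ioo (-Real.pi) Real.pi, ∀ y ∈ Ioo (-Real.pi) Real.pi,
      F y - F x = ∫ t in x..y, k t)
    (hk : ∀ᵐ t ∂torusMeasure, t ∈ W → k t = κ t) (hκ : ContinuousOn κ W) {u : ℝ} (hu : u ∈ W) :
    HasDerivAt F (κ u) u := by
  have hd : HasDerivAt (fun v => ∫ t in u..v, κ t) (κ u) u :=
    intervalIntegral.integral_hasDerivAt_right IntervalIntegrable.refl
      (hκ.stronglyMeasurableAtFilter hW u hu) (hκ.continuousAt (hW.mem_nhds hu))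
  refine (hd.const_add (F u)).congr_of_eventuallyEq ?_
  obtain ⟨ε, hε, hball⟩ := Metric.isOpen_iff.1 hW u hu
  filter_upwards [Metric.ball_mem_nhds u hε] with v hv
  have hseg : uIcc u v ⊆ W :=
    ((convex_ball (E := ℝ) u ε).ordConnected.uIcc_subset (Metric.mem_ball_self hε) hv).trans hball
  have hcongr : ∫ t in u..v, k t = ∫ t in u..v, κ t := by
    refine intervalIntegral.integral_congr_ae ?_
    filter_upwards [(ae_restrict_iff' measurableSet_Ioc).1 hk] with t ht hmem
    have hWt := hseg (uIoc_subset_uIcc hmem)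
    exact ht (Ioo_subset_Ioc_self (hsub hWt)) hWt
  rw [← hcongr, ← hF u (hsub hu) v (hsub (hball hv))]
  ring

/-- The flux of a weak solution has a continuous representative. -/
theorem IsWeakSolution.exists_flux {c : ℝ} {ζ : ℝ → ℝ} (h : IsWeakSolution c ζ) :
    ∃ Q : ℝ → ℝ, Continuous Q ∧ Q (-Real.pi) = Q Real.pi ∧
      ∀ u ∈ Ioo (-Real.pi) Real.pi, c ^ 2 - 2 * ζ u ≠ 0 →
        HasDerivAt ζ (Q u / (c ^ 2 - 2 * ζ u)) u ∧
        HasDerivAt Q (-(Q u / (c ^ 2 - 2 * ζ u)) ^ 2 - ζ u) u := by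
  obtain ⟨hζ, hper, g, hg, hg2, hweak⟩ := h
  have hgi := integrable_torusMeasure.1 hg.2.1
  have hsq : Integrable (fun u => g u ^ 2) torusMeasure :=
    (memLp_two_iff_integrable_sq hg2.1).1 hg2
  have hsqi := integrable_torusMeasure.1 hsq
  have hζi := hζ.intervalIntegrable (μ := volume) (-Real.pi) Real.pi
  have hwc : Continuous fun u => c ^ 2 - 2 * ζ u := by fun_prop
  have hwg := hgi.continuousOn_mul hwc.continuousOn
  have hflux : HasWeakDeriv (fun u => (c ^ 2 - 2 * ζ u) * g u) fun u => -g u ^ 2 - ζ u := by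
    refine ⟨integrable_torusMeasure.2 hwg, integrable_torusMeasure.2 ?_, fun φ hφ => ?_⟩
    · exact hsqi.neg.sub hζi
    · have hφc := hφ.smooth.continuous
      have h0 := hweak φ hφ
      rw [integral_torusMeasure] at h0 ⊢
      rw [integral_torusMeasure]
      have i1 := hwg.mul_continuousOn (hφ.continuous_deriv.continuousOn)
      have i2 := hsqi.mul_continuousOn hφc.continuousOn
      have i3 := hζi.mul_continuousOn hφc.continuousOn
      rw [intervalIntegral.integral_sub (i1.sub i2) i3, intervalIntegral.integral_sub i1 i2] at h0
      have : ∀ u, (-g u ^ 2 - ζ u) * φ u = -(g u ^ 2 * φ u) - ζ u * φ u := fun u => by ring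
      simp only [this]
      have i2' : IntervalIntegrable (fun u => -(g u ^ 2 * φ u)) volume (-Real.pi) Real.pi := i2.neg
      rw [intervalIntegral.integral_sub i2' i3, intervalIntegral.integral_neg]
      linarith
  obtain ⟨Q, hQ, hQπ, hae, hint⟩ := hflux.exists_primitive
  refine ⟨Q, hQ, hQπ, fun u hu hwu => ?_⟩
  set W := Ioo (-Real.pi) Real.pi ∩ {t | c ^ 2 - 2 * ζ t ≠ 0}
  have hW : IsOpen W := isOpen_Ioo.inter (isOpen_ne_fun hwc continuous_const)
  have hgQ : ∀ᵐ t ∂torusMeasure, t ∈ W → g t = Q t / (c ^ 2 - 2 * ζ t) := by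
    filter_upwards [hae] with t ht htW
    rw [← ht, mul_div_cancel_left₀ _ htW.2]
  have hκ : ContinuousOn (fun t => Q t / (c ^ 2 - 2 * ζ t)) W :=
    hQ.continuousOn.div hwc.continuousOn fun t ht => ht.2
  refine ⟨hasDerivAt_of_ae_eq hW inter_subset_left
    (fun x hx y hy => hg.sub_eq_integral hζ hx hy) hgQ hκ ⟨hu, hwu⟩, ?_⟩
  refine hasDerivAt_of_ae_eq (κ := fun t => -(Q t / (c ^ 2 - 2 * ζ t)) ^ 2 - ζ t) hW
    inter_subset_left (fun x hx y hy => hint x (Ioo_subset_Icc_self hx) y (Ioo_subset_Icc_self hy))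
    ?_ ((hκ.pow 2).neg.sub hζ.continuousOn) ⟨hu, hwu⟩
  filter_upwards [hgQ] with t ht htW
  rw [ht htW]

/-- The essential bound on the weak derivative becomes the slope bound needed by
`IsFluxSystem.energy_eq`. -/
theorem MemW1Infty.exists_lipschitz {ζ : ℝ → ℝ} (hζ : Continuous ζ) (h : MemW1Infty ζ) :
    ∃ K : ℝ, 0 ≤ K ∧ ∀ x ∈ Ioo (-Real.pi) Real.pi, ∀ y ∈ Ioo (-Real.pi) Real.pi,
      |ζ y - ζ x| ≤ K * |y - x| := by
  obtain ⟨-, g, hg, hgK⟩ := h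
  refine ⟨(eLpNorm g ⊤ torusMeasure).toReal, ENNReal.toReal_nonneg, fun x hx y hy => ?_⟩
  rw [hg.sub_eq_integral hζ hx hy]
  have hb : ∀ᵐ t ∂torusMeasure, ‖g t‖ ≤ (eLpNorm g ⊤ torusMeasure).toReal := by
    rw [eLpNorm_exponent_top]
    have hfin := hgK.2
    rw [eLpNorm_exponent_top] at hfin
    filter_upwards [ae_le_eLpNormEssSup (f := g) (μ := torusMeasure)] with t ht
    rw [← toReal_enorm]
    exact ENNReal.toReal_mono hfin.ne ht
  rw [← Real.norm_eq_abs]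
  refine intervalIntegral.norm_integral_le_of_norm_le_const_ae ?_
  filter_upwards [(ae_restrict_iff' measurableSet_Ioc).1 hb] with t ht hmem
  exact ht ⟨(lt_min hx.1 hy.1).trans hmem.1, hmem.2.trans (max_le hx.2.le hy.2.le)⟩

/-! ### Uniqueness at the threshold speed -/

theorem cornerWave_unique {ζ : ℝ → ℝ} (h : IsContinuousWave cStar ζ) (hW : MemW1Infty ζ) :
    ζ = cornerWave := by
  obtain ⟨hl, hweak⟩ := h
  have hζ := hweak.1
  have hπ := Real.pi_pos
  have hc := cStar_pos
  obtain ⟨Q, hQ, hQπ, hd⟩ := hweak.exists_flux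
  obtain ⟨K, hK0, hK⟩ := hW.exists_lipschitz hζ
  have ha := hl.strictAntiOn hζ
  have hsub : ∀ u ∈ Ioo 0 Real.pi, u ∈ Ioo (-Real.pi) Real.pi := fun u hu =>
    ⟨by linarith [hu.1], hu.2⟩
  have hsys : IsFluxSystem cStar ζ Q := ⟨hζ, hQ.continuousOn, ha,
    fun u hu hw => (hd u (hsub u hu) hw).1, fun u hu hw => (hd u (hsub u hu) hw).2⟩
  -- Evenness of ζ makes the slope, hence the flux, odd wherever the level is not critical.
  have hodd : ∀ u ∈ Ioo (-Real.pi) Real.pi, cStar ^ 2 - 2 * ζ u ≠ 0 → Q (-u) = -Q u := by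
    intro u hu hw
    have hu' : -u ∈ Ioo (-Real.pi) Real.pi := ⟨by linarith [hu.2], by linarith [hu.1]⟩
    have h1 := (hd u hu hw).1
    have h2 := (hd (-u) hu' (by rwa [hl.even])).1.scomp u (hasDerivAt_neg u)
    have h3 : ζ ∘ Neg.neg = ζ := funext hl.even
    rw [show (ζ ∘ fun x => -x) = ζ from h3, hl.even] at h2
    have := h1.unique h2
    rw [smul_eq_mul] at this
    field_simp at this
    linarith
  have h0mem : (0 : ℝ) ∈ Ioo (-Real.pi) Real.pi := ⟨by linarith, hπ⟩
  have hQ0 : cStar ^ 2 - 2 * ζ 0 ≠ 0 → Q 0 = 0 := by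
    intro hw
    have := hodd 0 h0mem hw
    rw [neg_zero] at this
    linarith
  have hle0 := apply_le_zero_of_strictAntiOn hl.periodic hl.even ha
  rcases lt_trichotomy (ζ 0) (cStar ^ 2 / 2) with hlt | heq | hgt
  · exfalso
    have hw : ∀ u, 0 < cStar ^ 2 - 2 * ζ u := fun u => by linarith [hle0 u]
    -- Oddness extends to the endpoints by continuity; with Q(−π) = Q(π) it forces Q(π) = 0.
    have hlim : EqOn (fun u => Q (-u)) (fun u => -Q u) (Icc (-Real.pi) Real.pi) := by
      have : EqOn (fun u => Q (-u)) (fun u => -Q u) (Ioo (-Real.pi) Real.pi) :=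
        fun u hu => hodd u hu (hw u).ne'
      refine this.of_subset_closure (by fun_prop) (by fun_prop) Ioo_subset_Icc_self ?_
      rw [closure_Ioo (by linarith)]
    have hQpi : Q Real.pi = 0 := by
      have := hlim ⟨by linarith, le_rfl⟩
      simp only [hQπ] at this
      linarith
    obtain ⟨hmem, hT, -⟩ := hsys.exists_angle hw (hQ0 (hw 0).ne') hQpi
    -- At c_* the half period equals π only at the excluded amplitude c²/2; every smaller amplitude
    -- has a longer one.
    have := strictAntiOn_halfPeriod cStar (Ioo_subset_Icc_self hmem)
      ⟨by positivity, le_rfl⟩ hmem.2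
    rw [hT, halfPeriod_max hc.le, two_sqrt_two_mul_cStar] at this
    exact lt_irrefl _ this
  · refine eq_of_eqOn_of_periodic_of_even hl.periodic hl.even
      isContinuousWave_cornerWave.1.periodic isContinuousWave_cornerWave.1.even fun u hu => ?_
    have hbound : ∀ u ∈ Ioo 0 Real.pi, |Q u / (cStar ^ 2 - 2 * ζ u)| ≤ K := by
      intro u hu
      have hw : 0 < cStar ^ 2 - 2 * ζ u := by
        have := ha ⟨le_rfl, hπ.le⟩ (Ioo_subset_Icc_self hu) hu.1
        linarith
      refine (hsys.hasDerivAt u hu hw.ne').le_of_lip' hK0 ?_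
      filter_upwards [Ioo_mem_nhds hu.1 hu.2] with v hv
      exact hK u (hsub u hu) v (hsub v hv)
    rw [hsys.eq_of_eq hc heq hbound hu, cornerWave_eq hu]
    have h2 : √2 ^ 2 = 2 := Real.sq_sqrt (by norm_num)
    have h3 : u / (2 * √2) = cStar * (u / Real.pi) := by
      rw [cStar]
      field_simp
    rw [h3, show cStar - cStar * (u / Real.pi) = cStar * (1 - u / Real.pi) by ring, mul_pow,
      cStar_sq]
    field_simp
    ring
  · exact absurd hgt (hsys.not_lt (hQ0 (by linarith)))

/-! ### Assembly of the three statements -/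

theorem smooth_waves_exist_unique :
    ∃ η : ℝ → ℝ → ℝ,
      (∀ c ∈ Ioo 1 cStar, IsSmoothWave c (η c) ∧ ∀ ζ : ℝ → ℝ, IsSmoothWave c ζ → ζ = η c) ∧
      Tendsto (fun c => eLpNorm (η c) ⊤ torusMeasure) (𝓝[>] 1) (𝓝 0) := by
  have hex : ∀ c, ∃ η : ℝ → ℝ, c ∈ Ioo 1 cStar → IsSmoothWave c η ∧
      (η 0 ∈ Ioo 0 (c ^ 2 / 2) ∧ halfPeriod c (η 0) = Real.pi) ∧ ∀ u, |η u| ≤ η 0 := by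
    intro c
    by_cases hc : c ∈ Ioo 1 cStar
    · obtain ⟨a, ha, h⟩ := exists_halfPeriod_eq hc
      have h0 : a * Real.cos ((isClock_smoothDensity ha h).phase 0) = a := by
        rw [(isClock_smoothDensity ha h).phase_zero, Real.cos_zero, mul_one]
      refine ⟨_, fun _ => ⟨isSmoothWave_smooth ha h, ?_, fun u => ?_⟩⟩
      · simp only [h0]
        exact ⟨ha, h⟩
      · simp only [h0]
        rw [abs_mul, abs_of_pos ha.1]
        exact mul_le_of_le_one_right ha.1.le (Real.abs_cos_le_one _)
    -- Outside (1, c_*) the family takes an arbitrary value; the limit c → 1⁺ does not see it.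
    · exact ⟨0, fun h => absurd h hc⟩
  choose η hη using hex
  refine ⟨η, fun c hc => ⟨(hη c hc).1, fun ζ hζ =>
    hζ.unique (zero_lt_one.trans hc.1) (hη c hc).1⟩, ?_⟩
  have hlim := tendsto_amplitude (a := fun c => η c 0) fun c hc => (hη c hc).2.1
  have hlim' : Tendsto (fun c => ENNReal.ofReal (η c 0)) (𝓝[>] 1) (𝓝 0) := by
    simpa using ENNReal.tendsto_ofReal hlim
  refine tendsto_of_tendsto_of_tendsto_of_le_of_le' tendsto_const_nhds hlim'
    (Eventually.of_forall fun _ => bot_le) ?_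
  filter_upwards [Ioo_mem_nhdsGT one_lt_cStar] with c hc
  rw [eLpNorm_exponent_top]
  exact eLpNormEssSup_le_of_ae_bound (Eventually.of_forall (hη c hc).2.2)

end StokesWave

theorem theorem1 :
    (∃ η : ℝ → ℝ → ℝ,
      (∀ c ∈ Set.Ioo 1 StokesWave.cStar,
        StokesWave.IsSmoothWave c (η c) ∧
          ∀ ζ : ℝ → ℝ, StokesWave.IsSmoothWave c ζ → ζ = η c) ∧
      Filter.Tendsto (fun c => eLpNorm (η c) ⊤ StokesWave.torusMeasure)
        (nhdsWithin 1 (Set.Ioi 1)) (nhds 0)) ∧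
    (∃ cInf : ℝ, StokesWave.cStar < cInf ∧
      ∀ c ∈ Set.Ioo StokesWave.cStar cInf,
        ∃ η : ℝ → ℝ, StokesWave.IsContinuousWave c η ∧
          (∀ u : ℝ, u ∉ StokesWave.lattice → StokesWave.IsClassicalSolutionAt c η u) ∧
          ∃ A : ℝ, 0 < A ∧
            (fun u : ℝ => η u - (c ^ 2 / 2 - A * |u| ^ (2 / 3 : ℝ)))
              =O[nhds 0] (fun u : ℝ => |u| ^ (4 / 3 : ℝ))) ∧
    (∃ η : ℝ → ℝ,
      (StokesWave.IsContinuousWave StokesWave.cStar η ∧ StokesWave.MemW1Infty η) ∧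
      (∀ u : ℝ, u ∉ StokesWave.lattice →
        StokesWave.IsClassicalSolutionAt StokesWave.cStar η u) ∧
      (∀ ζ : ℝ → ℝ, StokesWave.IsContinuousWave StokesWave.cStar ζ →
        StokesWave.MemW1Infty ζ → ζ = η) ∧
      ∀ u ∈ Set.Icc (-Real.pi) Real.pi,
        η u = (Real.pi ^ 2 - 4 * Real.pi * |u| + 2 * u ^ 2) / 16) := by
  refine ⟨StokesWave.smooth_waves_exist_unique, ?_, StokesWave.cornerWave,
    ⟨StokesWave.isContinuousWave_cornerWave, StokesWave.memW1Infty_cornerWave⟩,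
    fun u hu => StokesWave.isClassicalSolutionAt_cusp StokesWave.cStar_pos le_rfl
      StokesWave.cStar_mul_cuspHalfPeriod_two hu,
    fun ζ hζ hW => StokesWave.cornerWave_unique hζ hW, fun u hu => StokesWave.cornerWave_eq_abs hu⟩
  obtain ⟨cInf, hlt, h⟩ := StokesWave.exists_cuspHalfPeriod_eq
  refine ⟨cInf, hlt, fun c hc => ?_⟩
  have hc0 : 0 < c := StokesWave.cStar_pos.trans hc.1
  obtain ⟨m, hm, hT⟩ := h c hc
  exact ⟨_, (StokesWave.isContinuousWave_cusp hc0 hm.le hT).1,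
    fun u hu => StokesWave.isClassicalSolutionAt_cusp hc0 hm.le hT hu,
    StokesWave.cusp_isBigO hc0 hm hT⟩
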